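/- Let $k$ be an algebraically closed field of characteristic $0$ and let $Y$ be a smooth projective (integral) surface over $k$. Let $\sigma$ be a $k$-automorphism of $Y$ of order $2$, let $L$ be a line bundle on $Y$, and let $\phi : L\otimes\sigma^*L \to \mathcal O_Y$ be an isomorphism. For an $\mathcal O_Y$-module $M$ write $L_\sigma\otimes_Y M := L\otimes\sigma^*M$. Assume that $\phi$ satisfies the overlap condition, i.e. the two maps $\phi\otimes 1,\ 1\otimes\phi : L_\sigma\otimes_Y L_\sigma\otimes_Y L_\sigma\to L_\sigma$ agree: $\phi(s\otimes\sigma^*s')\,s''=\sigma^*\!\big(\phi(s'\otimes\sigma^*s'')\big)\,s$ for all local sections $s\in L(U)$, $s'\in L(\sigma U)$, $s''\in L(\sigma^2U)=L(U)$. Let $A=\mathcal O_Y\oplus L_\sigma$ be the resulting cyclic algebra, in which the product $L_\sigma\otimes_Y L_\sigma\to\mathcal O_Y$ is given by $\phi$; a left $A$-module is an $\mathcal O_Y$-module $M$ with a unital and associative action $A\otimes_Y M = M\oplus (L_\sigma\otimes_Y M)\to M$. Assume finally that $L$ is not a $1$-coboundary for $\langle\sigma\rangle$ acting on $\operatorname{Pic}Y$,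 i.e. there is no line bundle $N$ on $Y$ with $L\simeq N\otimes(\sigma^*N)^{-1}$. Let $M$ be a vector bundle of rank two on $Y$. 1. If $M$ is split, i.e. isomorphic to a direct sum of two line bundles, then any two $A$-module structures on $M$ extending its $\mathcal O_Y$-module structure give isomorphic $A$-modules. 2. Suppose that $M$ is simple over $Y$, i.e. $\operatorname{End}_Y(M)=k$. If $L_\sigma\otimes_Y M\not\simeq M$ as $\mathcal O_Y$-modules, then $M$ has no $A$-module structure extending its $\mathcal O_Y$-module structure. If $L_\sigma\otimes_Y M\simeq M$, then there are exactly two such $A$-module structures on $M$, and the two resulting $A$-modules are not isomorphic. -/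

import Mathlib

open CategoryTheory Limits Opposite MonoidalCategory AlgebraicGeometry Scheme.Modules

universe u

noncomputable section

namespace CyclicCover

variable {X : Scheme.{u}}

/-- Presheaves of modules over the structure presheaf of commutative rings of `X`; this is the
form of `X.PresheafOfModules` on which Mathlib puts the sectionwise tensor product. -/
abbrev PMod (X : Scheme.{u}) := _root_.PresheafOfModules.{u} (X.presheaf ⋙ forget₂ CommRingCat.{u} RingCat.{u})

/-- The functor `G ↦ F ⊗ G` on `𝒪_X`-modules: the sheaf associated with the presheaf
`U ↦ F(U) ⊗_{𝒪(U)} G(U)`. -/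
def tensorLeft (F : X.Modules) : X.Modules ⥤ X.Modules :=
  (toPresheafOfModules X ⋙ MonoidalCategory.tensorLeft (C := PMod X) F.val :
     X.Modules ⥤ X.PresheafOfModules) ⋙
    PresheafOfModules.sheafification (𝟙 X.ringCatSheaf.obj)

/-- The tensor product `F ⊗ G` of two `𝒪_X`-modules. -/
abbrev tensor (F G : X.Modules) : X.Modules := (tensorLeft F).obj G

/-- The presheaf `U ↦ F(U) ⊗_{𝒪(U)} G(U)`. -/
abbrev presheafTensor (F G : X.Modules) : X.PresheafOfModules :=
  MonoidalCategory.tensorObj (C := PMod X) F.val G.val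

/-- The canonical map from the presheaf tensor product to the tensor product. -/
def toTensor (F G : X.Modules) : presheafTensor F G ⟶ (tensor F G).val :=
  PresheafOfModules.sheafificationHomEquiv (𝟙 X.ringCatSheaf.obj) (𝟙 _)

/-- The pure tensor `s ⊗ t` in the presheaf tensor product. -/
def ptmul {F G : X.Modules} {U : X.Opens} (s : Γ(F, U)) (t : Γ(G, U)) : (presheafTensor F G).obj (op U) :=
  TensorProduct.tmul (R := Γ(X, U)) (M := Γ(F, U)) (N := Γ(G, U)) s t

/-- The section `s ⊗ t` of `F ⊗ G` over `U`. -/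
def tmul {F G : X.Modules} {U : X.Opens} (s : Γ(F, U)) (t : Γ(G, U)) : Γ(tensor F G, U) :=
  (toTensor F G).app (op U) (ptmul s t)

variable {F G H : X.Modules} {U V : X.Opens}

lemma smul_tmul (r : Γ(X, U)) (s : Γ(F, U)) (t : Γ(G, U)) : tmul (r • s) t = r • tmul s t := by
  unfold tmul
  exact ((toTensor F G).app (op U)).hom.map_smul r (ptmul s t)

lemma tmul_smul (r : Γ(X, U)) (s : Γ(F, U)) (t : Γ(G, U)) : tmul s (r • t) = r • tmul s t := by
  rw [← smul_tmul]
  unfold tmul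
  congr 1
  exact TensorProduct.tmul_smul (R := Γ(X, U)) (M := Γ(F, U)) (N := Γ(G, U)) r s t

lemma tmul_add (s : Γ(F, U)) (t t' : Γ(G, U)) : tmul s (t + t') = tmul s t + tmul s t' :=
  (congrArg ((toTensor F G).app (op U)).hom
    (TensorProduct.tmul_add (R := Γ(X, U)) (M := Γ(F, U)) (N := Γ(G, U)) s t t')).trans
    (((toTensor F G).app (op U)).hom.map_add (ptmul s t) (ptmul s t'))

lemma add_tmul (s s' : Γ(F, U)) (t : Γ(G, U)) : tmul (s + s') t = tmul s t + tmul s' t :=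
  (congrArg ((toTensor F G).app (op U)).hom
    (TensorProduct.add_tmul (R := Γ(X, U)) (M := Γ(F, U)) (N := Γ(G, U)) s s' t)).trans
    (((toTensor F G).app (op U)).hom.map_add (ptmul s t) (ptmul s' t))

lemma map_tmul (i : U ⟶ V) (s : Γ(F, V)) (t : Γ(G, V)) :
    (tensor F G).presheaf.map i.op (tmul s t) = tmul (F.presheaf.map i.op s) (G.presheaf.map i.op t) := by
  unfold tmul
  have := PresheafOfModules.naturality_apply (toTensor F G) i.op (ptmul s t)
  exact this.symm

lemma homEquiv_apply (f : tensor F G ⟶ H) (p : (presheafTensor F G).obj (op U)) :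
    DFunLike.coe (F := Γ(tensor F G, U) →+ Γ(H, U)) (f.app U).hom ((toTensor F G).app (op U) p) =
      (PresheafOfModules.sheafificationHomEquiv (𝟙 X.ringCatSheaf.obj) f).app (op U) p := by
  have h1 := PresheafOfModules.toPresheaf_map_sheafificationHomEquiv_def (𝟙 X.ringCatSheaf.obj) f
  have h2 := PresheafOfModules.toPresheaf_map_sheafificationHomEquiv_def (𝟙 X.ringCatSheaf.obj) (𝟙 (tensor F G))
  have h1' := congrArg (fun g => (g.app (op U)).hom p) h1
  have h2' := congrArg (fun g => (g.app (op U)).hom p) h2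
  refine Eq.trans ?_ h1'.symm
  exact congrArg (f.app U).hom h2'

lemma tensorLeft_map_tmul (f : G ⟶ H) (s : Γ(F, U)) (t : Γ(G, U)) :
   ((tensorLeft F).map f).app U (tmul s t) = tmul s (f.app U t) := by
  refine (homEquiv_apply _ _).trans ?_
  have h := (PresheafOfModules.sheafificationAdjunction (𝟙 X.ringCatSheaf.obj)).homEquiv_naturality_left
    (MonoidalCategory.whiskerLeft (C := PMod X) F.val f.val) (𝟙 (tensor F H))
  have h' := congrArg (fun g => (g.app (op U)).hom (ptmul s t)) h
  refine Eq.trans ?_ h'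
  erw [Category.comp_id]
  rfl

/-- Bilinear maps of `𝒪_X`-modules `F × G → H`. -/
structure Bil (F G H : X.Modules) where
  toFun (U : X.Opens) : Γ(F, U) → Γ(G, U) → Γ(H, U)
  add_left : ∀ U s s' t, toFun U (s + s') t = toFun U s t + toFun U s' t
  add_right : ∀ U s t t', toFun U s (t + t') = toFun U s t + toFun U s t'
  smul_left : ∀ U (r : Γ(X, U)) s t, toFun U (r • s) t = r • toFun U s t
  smul_right : ∀ U (r : Γ(X, U)) s t, toFun U s (r • t) = r • toFun U s t
  map : ∀ {U V} (i : U ⟶ V) s t, H.presheaf.map i.op (toFun V s t) = toFun U (F.presheaf.map i.op s) (G.presheaf.map i.op t)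

/-- The map of presheaves defined by a bilinear map. -/
def Bil.presheafHom (b : Bil F G H) : presheafTensor F G ⟶ H.val where
  app U := ModuleCat.ofHom (X := (presheafTensor F G).obj U) (Y := H.val.obj U) (R := (X.ringCatSheaf.obj.obj U))
     (show TensorProduct Γ(X, U.unop) Γ(F, U.unop) Γ(G, U.unop) →ₗ[Γ(X, U.unop)] Γ(H, U.unop) from TensorProduct.lift (R := Γ(X, U.unop)) (M := Γ(F, U.unop)) (N := Γ(G, U.unop)) (P₂ := Γ(H, U.unop))
     (LinearMap.mk₂ _ (b.toFun U.unop) (b.add_left _) (b.smul_left _) (b.add_right _) (b.smul_right _)))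
  naturality {U V} i := ModuleCat.MonoidalCategory.tensor_ext (by
    intro s t
    exact (b.map i.unop s t).symm)

/-- The morphism `F ⊗ G ⟶ H` defined by a bilinear map `F × G → H`. -/
def Bil.lift (b : Bil F G H) : tensor F G ⟶ H :=
  (PresheafOfModules.sheafificationHomEquiv (𝟙 X.ringCatSheaf.obj)).symm b.presheafHom

lemma Bil.lift_tmul (b : Bil F G H) (s : Γ(F, U)) (t : Γ(G, U)) : b.lift.app U (tmul s t) = b.toFun U s t := by
  refine (homEquiv_apply _ _).trans ?_
  unfold lift
  erw [Equiv.apply_symm_apply]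
  rfl

lemma toTensor_presheaf : (PresheafOfModules.toPresheaf _).map (toTensor F G) =
   CategoryTheory.toSheafify (Opens.grothendieckTopology X) (presheafTensor F G).presheaf := by
  refine (PresheafOfModules.toPresheaf_map_sheafificationHomEquiv_def (𝟙 X.ringCatSheaf.obj) (𝟙 (tensor F G))).trans ?_
  exact Category.comp_id _

/-- Restriction of sections of the presheaf tensor product. -/
def pres (F G : X.Modules) (i : V ⟶ U) :
    (presheafTensor F G).obj (op U) →+ (presheafTensor F G).obj (op V) :=
  ((presheafTensor F G).presheaf.map i.op).hom

lemma pres_ptmul (i : V ⟶ U) (s : Γ(F, U)) (t : Γ(G, U)) :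
    pres F G i (ptmul s t) = ptmul (F.presheaf.map i.op s) (G.presheaf.map i.op t) := rfl

/-- The canonical map from the presheaf tensor product to the tensor product, on sections. -/
def toTensorHom (F G : X.Modules) (U : X.Opens) :
    (presheafTensor F G).obj (op U) →+ Γ(tensor F G, U) :=
  ((toTensor F G).app (op U)).hom.toAddMonoidHom

lemma toTensorHom_ptmul (s : Γ(F, U)) (t : Γ(G, U)) : toTensorHom F G U (ptmul s t) = tmul s t := rfl

lemma map_toTensorHom (i : V ⟶ U) (q : (presheafTensor F G).obj (op U)) :
    (tensor F G).presheaf.map i.op (toTensorHom F G U q) = toTensorHom F G V (pres F G i q) :=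
  (PresheafOfModules.naturality_apply (toTensor F G) i.op q).symm

lemma exists_local_lift (x : Γ(tensor F G, U)) (p : X) (hp : p ∈ U) :
    ∃ (V : X.Opens) (i : V ⟶ U), p ∈ V ∧ ∃ q : (presheafTensor F G).obj (op V),
      toTensorHom F G V q = (tensor F G).presheaf.map i.op x := by
  have := Presheaf.imageSieve_mem (Opens.grothendieckTopology X)
    (CategoryTheory.toSheafify (Opens.grothendieckTopology X) (presheafTensor F G).presheaf) (U := op U) x
  obtain ⟨V, i, ⟨q, hq⟩, hV⟩ := this p hp
  refine ⟨V, i, hV, q, ?_⟩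
  rw [← toTensor_presheaf] at hq
  exact hq

lemma local_inj (q q' : (presheafTensor F G).obj (op U))
    (h : toTensorHom F G U q = toTensorHom F G U q') (p : X) (hp : p ∈ U) :
    ∃ (V : X.Opens) (i : V ⟶ U), p ∈ V ∧ pres F G i q = pres F G i q' := by
  have := Presheaf.equalizerSieve_mem (Opens.grothendieckTopology X)
    (CategoryTheory.toSheafify (Opens.grothendieckTopology X) (presheafTensor F G).presheaf) (X := op U) q q'
    (by rw [← toTensor_presheaf]; exact h)
  obtain ⟨V, i, hi, hV⟩ := this p hp
  exact ⟨V, i, hV, hi⟩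

lemma presheafTensor_induction {C : (presheafTensor F G).obj (op U) → Prop}
    (tmul : ∀ s t, C (ptmul s t)) (add : ∀ x y, C x → C y → C (x + y)) (q) : C q := by
  have key (C : TensorProduct Γ(X, U) Γ(F, U) Γ(G, U) → Prop)
      (h : ∀ s t, C (TensorProduct.tmul Γ(X, U) s t)) (h' : ∀ x y, C x → C y → C (x + y)) q : C q :=
    TensorProduct.induction_on q (by simpa using h 0 0) h h'
  exact key C tmul add q

lemma map_map (M : X.Modules) {W : X.Opens} (i : V ⟶ U) (j : W ⟶ V) (k : W ⟶ U) (x : Γ(M, U)) :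
    M.presheaf.map j.op (M.presheaf.map i.op x) = M.presheaf.map k.op x := by
  rw [← ConcreteCategory.comp_apply, ← Functor.map_comp]
  rfl

lemma pres_pres {W : X.Opens} (i : V ⟶ U) (j : W ⟶ V) (k : W ⟶ U)
    (q : (presheafTensor F G).obj (op U)) :
    pres F G j (pres F G i q) = pres F G k q := by
  refine presheafTensor_induction (C := fun q => pres F G j (pres F G i q) = pres F G k q) ?_ ?_ q
  · intro s t
    rw [pres_ptmul, pres_ptmul, pres_ptmul, map_map F i j k, map_map G i j k]
  · intro x y hx hy
    rw [map_add, map_add, map_add, hx, hy]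

lemma section_ext (M : X.Modules) (x y : Γ(M, U))
    (h : ∀ p ∈ U, ∃ (V : X.Opens) (i : V ⟶ U), p ∈ V ∧ M.presheaf.map i.op x = M.presheaf.map i.op y) :
    x = y := by
  choose V i hV h using h
  refine TopCat.Sheaf.eq_of_locally_eq' (⟨M.presheaf, M.isSheaf⟩ : TopCat.Sheaf Ab X) (fun p : U => V p.1 p.2) U
    (fun p => i p.1 p.2) ?_ x y (fun p => h p.1 p.2)
  intro p hp
  exact TopologicalSpace.Opens.mem_iSup.mpr ⟨⟨p, hp⟩, hV p hp⟩

lemma exists_glue (M : X.Modules) (U : X.Opens) (R : ∀ V : X.Opens, Γ(M, V) → Prop)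
    (hres : ∀ (V W : X.Opens) (j : W ⟶ V) y, R V y → R W (M.presheaf.map j.op y))
    (huniq : ∀ V y y', R V y → R V y' → y = y')
    (hloc : ∀ p ∈ U, ∃ (V : X.Opens) (_ : V ⟶ U), p ∈ V ∧ ∃ y, R V y) :
    ∃ y : Γ(M, U), ∀ V (i : V ⟶ U) y', R V y' → M.presheaf.map i.op y = y' := by
  choose V i hV y hy using hloc
  obtain ⟨z, hz, -⟩ := TopCat.Sheaf.existsUnique_gluing' (⟨M.presheaf, M.isSheaf⟩ : TopCat.Sheaf Ab X)
    (fun p : U => V p.1 p.2) U (fun p => i p.1 p.2)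
    (fun p hp => TopologicalSpace.Opens.mem_iSup.mpr ⟨⟨p, hp⟩, hV p hp⟩)
    (fun p => y p.1 p.2) (fun p q => huniq _ _ _ (hres _ _ _ _ (hy p.1 p.2)) (hres _ _ _ _ (hy q.1 q.2)))
  refine ⟨z, fun W j y' hR => ?_⟩
  refine section_ext M _ _ fun p hp => ?_
  have hpU := leOfHom j hp
  refine ⟨W ⊓ V p hpU, homOfLE inf_le_left, ⟨hp, hV _ _⟩, ?_⟩
  refine Eq.trans ?_ (huniq _ _ _ (hres _ _ (homOfLE (inf_le_right : W ⊓ V p hpU ≤ _)) _ (hy p hpU)) (hres _ _ _ _ hR))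
  rw [← hz ⟨p, hpU⟩]
  simp only [← ConcreteCategory.comp_apply]
  erw [← Functor.map_comp, ← Functor.map_comp]
  rfl

lemma tensor_induction {C : ∀ U : X.Opens, Γ(tensor F G, U) → Prop}
    (pure : ∀ U (s : Γ(F, U)) (t : Γ(G, U)), C U (tmul s t))
    (add : ∀ U x y, C U x → C U y → C U (x + y))
    (loc : ∀ U x, (∀ p ∈ U, ∃ (V : X.Opens) (i : V ⟶ U), p ∈ V ∧
      C V ((tensor F G).presheaf.map i.op x)) → C U x) (U : X.Opens) (x : Γ(tensor F G, U)) :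
    C U x := by
  refine loc U x fun p hp => ?_
  obtain ⟨V, i, hV, q, hq⟩ := exists_local_lift x p hp
  refine ⟨V, i, hV, hq ▸ ?_⟩
  clear hq
  refine presheafTensor_induction (C := fun q => C V (toTensorHom F G V q)) (pure V) ?_ q
  intro x y hx hy
  rw [map_add]
  exact add V _ _ hx hy

lemma tensor_hom_ext {f g : tensor F G ⟶ H}
    (h : ∀ (U : X.Opens) (s : Γ(F, U)) (t : Γ(G, U)), f.app U (tmul s t) = g.app U (tmul s t)) :
    f = g := by
  ext U x
  refine tensor_induction (C := fun U x => f.app U x = g.app U x) h ?_ ?_ U x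
  · intro U x y hx hy
    rw [map_add, map_add, hx, hy]
  · intro U x hx
    refine section_ext _ _ _ fun p hp => ?_
    obtain ⟨V, i, hV, h⟩ := hx p hp
    refine ⟨V, i, hV, ?_⟩
    have e (f : tensor F G ⟶ H) : H.presheaf.map i.op (f.app U x) = f.app V ((tensor F G).presheaf.map i.op x) :=
      (PresheafOfModules.naturality_apply f.val i.op x).symm
    rw [e, e, h]

variable {Y : Scheme.{u}}

/-- The monad `X ↦ X ⊕ F X` with unit the inclusion of `X` and with multiplication given by the
identity on the summands `X`, `F X`, `F X` of `X ⊕ F X ⊕ F X ⊕ F F X`, and by `θ : F F X ⟶ X` on the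
last one. -/
def quadraticMonad {C : Type*} [Category* C] [Preadditive C] [HasBinaryBiproducts C] (F : C ⥤ C)
    [F.Additive] (θ : F ⋙ F ⟶ 𝟭 C) (h : ∀ X, F.map (θ.app X) = θ.app (F.obj X)) : Monad C where
  obj X := X ⊞ F.obj X
  map f := biprod.map f (F.map f)
  map_id X := by ext <;> simp
  map_comp f g := by ext <;> simp
  η := { app := fun X => biprod.inl, naturality := fun X Y f => by simp }
  μ :=
    { app := fun X => biprod.desc (𝟙 (X ⊞ F.obj X))
        (F.map biprod.fst ≫ biprod.inr + F.map biprod.snd ≫ θ.app X ≫ biprod.inl)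
      naturality := fun X Y f => by
        have hθ := θ.naturality f
        dsimp at hθ
        apply biprod.hom_ext'
        · simp
        · simp only [Functor.comp_obj, Functor.comp_map, Functor.id_obj, biprod.inr_map_assoc,
            biprod.inr_desc, biprod.inr_desc_assoc, Preadditive.comp_add, Preadditive.add_comp,
            Category.assoc, biprod.inl_map, biprod.inr_map]
          simp only [← Functor.map_comp_assoc, biprod.map_fst, biprod.map_snd]
          simp only [Functor.map_comp, Category.assoc, reassoc_of% hθ] }
  assoc X := by
    have hθ := θ.naturality (biprod.fst : X ⊞ F.obj X ⟶ _)
    have hθ' := θ.naturality (biprod.snd : X ⊞ F.obj X ⟶ _)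
    dsimp at hθ hθ'
    apply biprod.hom_ext'
    · simp
    · have e1 : biprod.desc (𝟙 (X ⊞ F.obj X))
          (F.map biprod.fst ≫ biprod.inr + F.map biprod.snd ≫ θ.app X ≫ biprod.inl) ≫ biprod.fst =
          biprod.fst ≫ biprod.fst + biprod.snd ≫ F.map biprod.snd ≫ θ.app X := by
        apply biprod.hom_ext' <;> simp
      have e2 : biprod.desc (𝟙 (X ⊞ F.obj X))
          (F.map biprod.fst ≫ biprod.inr + F.map biprod.snd ≫ θ.app X ≫ biprod.inl) ≫ biprod.snd =
          biprod.fst ≫ biprod.snd + biprod.snd ≫ F.map biprod.fst := by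
        apply biprod.hom_ext' <;> simp
      have e3 : θ.app (X ⊞ F.obj X) = F.map (F.map biprod.fst) ≫ θ.app X ≫ biprod.inl +
          F.map (F.map biprod.snd) ≫ F.map (θ.app X) ≫ biprod.inr := by
        rw [h, reassoc_of% hθ, reassoc_of% hθ', ← Preadditive.comp_add]
        exact (Category.comp_id _).symm.trans (congrArg (θ.app _ ≫ ·) biprod.total.symm)
      simp only [Functor.id_obj, Functor.comp_obj, biprod.inr_map_assoc, biprod.inr_desc,
        Preadditive.comp_add, biprod.inr_desc_assoc, Preadditive.add_comp, Category.assoc,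
        biprod.inl_desc, Category.comp_id]
      have e4 := congrArg F.map e1
      have e5 := congrArg F.map e2
      simp only [Functor.map_add, Functor.map_comp] at e4 e5
      have e6 := congrArg (· ≫ (biprod.inr : F.obj X ⟶ X ⊞ F.obj X)) e4
      have e7 := congrArg (· ≫ θ.app X ≫ (biprod.inl : X ⟶ X ⊞ F.obj X)) e5
      simp only [Preadditive.add_comp, Category.assoc] at e6 e7
      refine (congrArg₂ (· + ·) e6 e7).trans ?_
      rw [e3]
      simp only [Preadditive.comp_add]
      have key (a b c d : F.obj ((X ⊞ F.obj X) ⊞ F.obj (X ⊞ F.obj X)) ⟶ X ⊞ F.obj X) :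
          a + d + (b + c) = a + b + (c + d) := by abel
      exact key _ _ _ _
  left_unit X := by simp
  right_unit X := by
    apply biprod.hom_ext'
    · simp
    · simp only [Functor.id_obj, biprod.inr_map_assoc, biprod.inr_desc, Preadditive.comp_add]
      simp [← Functor.map_comp_assoc]

/-- The structures of module over a monad `T` on a given object `M`. -/
structure ModuleStructure {C : Type*} [Category* C] (T : Monad C) (M : C) where
  /-- The action. -/
  act : T.obj M ⟶ M
  unit : T.η.app M ≫ act = 𝟙 M
  assoc : T.μ.app M ≫ act = T.map act ≫ act

/-- The module given by an object `M` with a module structure. -/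
def ModuleStructure.toModule {C : Type*} [Category* C] {T : Monad C} {M : C}
    (S : ModuleStructure T M) : T.Algebra where
  A := M
  a := S.act
  unit := S.unit
  assoc := S.assoc

/-- The structure sheaf as a module over itself. -/
abbrev structureSheaf (Y : Scheme.{u}) : Y.Modules := SheafOfModules.unit Y.ringCatSheaf

/-- A section of the structure sheaf, seen as a function. -/
def toRing {U : Y.Opens} (f : Γ(structureSheaf Y, U)) : Γ(Y, U) := f

/-- The data of a non-commutative cyclic double cover of `Y`: an automorphism `σ` with `σ² = 1`,
an `𝒪_Y`-module `L`, giving the bimodule `L_σ`, and a relation `φ : L_σ ⊗ L_σ ⟶ 𝒪_Y`, that is,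
a morphism `L ⊗ σ^* L ⟶ 𝒪_Y`.
Here `σ^* M` is `M.restrict σ.hom`, Mathlib's model of the pull-back of `M` along an open immersion,
with `Γ(σ^* M, U) = Γ(M, σ(U))`. -/
structure CyclicDatum (Y : Scheme.{u}) where
  /-- The automorphism of `Y`. -/
  σ : Y ≅ Y
  σ_sq : σ.hom ≫ σ.hom = 𝟙 Y
  /-- The module underlying the bimodule `L_σ`. -/
  L : Y.Modules
  /-- The relation. -/
  φ : tensor L (L.restrict σ.hom) ⟶ structureSheaf Y

namespace CyclicDatum
variable (D : CyclicDatum Y) {M N : Y.Modules} {U V : Y.Opens}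

/-- The image `σ(U)`. -/
abbrev img (U : Y.Opens) : Y.Opens := D.σ.hom ''ᵁ U

lemma img_img (U : Y.Opens) : D.img (D.img U) = U := by
  unfold img
  rw [← Scheme.Hom.comp_image]
  simp [D.σ_sq]

lemma img_mono (i : V ≤ U) : D.img V ≤ D.img U := Scheme.Hom.image_mono _ i

/-- The inclusion `σ(V) ⊆ σ(U)` for `V ⊆ U`. -/
def imgMap (i : V ⟶ U) : D.img V ⟶ D.img U := homOfLE (D.img_mono (leOfHom i))

/-- The pull-back `σ^* f ∈ 𝒪(U)` of a function `f` on `σ(U)`. -/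
def pullFun (f : Γ(Y, D.img U)) : Γ(Y, U) := (D.σ.hom.appIso U).hom f

/-- The identification `M(σ(σ(U))) = M(U)`. -/
def sqRes (M : Y.Modules) (t : Γ(M, D.img (D.img U))) : Γ(M, U) :=
  M.presheaf.map (eqToHom (D.img_img U).symm).op t

/-- The functor `M ↦ L_σ ⊗ M = L ⊗ σ^* M` on `𝒪_Y`-modules. -/
def twist : Y.Modules ⥤ Y.Modules := restrictFunctor D.σ.hom ⋙ tensorLeft D.L

/-- The section `s ⊗ σ^* t` of `L_σ ⊗ M` over `U`, for `s ∈ L(U)` and `t ∈ M(σ(U))`. -/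
def tw (s : Γ(D.L, U)) (t : Γ(M, D.img U)) : Γ(D.twist.obj M, U) :=
  tmul s ((M.restrictAppIso D.σ.hom U).inv t)

/-- The function `φ(s ⊗ σ^* t)` on `U`, for `s ∈ L(U)` and `t ∈ L(σ(U))`. -/
def pair (s : Γ(D.L, U)) (t : Γ(D.L, D.img U)) : Γ(Y, U) :=
  toRing (D.φ.app U (tmul s ((D.L.restrictAppIso D.σ.hom U).inv t)))

lemma pair_add_left (s s' : Γ(D.L, U)) (t) : D.pair (s + s') t = D.pair s t + D.pair s' t := by
  unfold pair toRing
  rw [add_tmul, map_add]; rfl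

lemma pair_add_right (s : Γ(D.L, U)) (t t') : D.pair s (t + t') = D.pair s t + D.pair s t' := by
  unfold pair toRing
  rw [map_add, tmul_add, map_add]; rfl

lemma pair_smul_left (r : Γ(Y, U)) (s : Γ(D.L, U)) (t) : D.pair (r • s) t = r * D.pair s t := by
  unfold pair toRing
  rw [smul_tmul, Scheme.Modules.Hom.app_smul]; rfl

lemma pair_smul_right (r : Γ(Y, D.img U)) (s : Γ(D.L, U)) (t) : D.pair s (r • t) = D.pullFun r * D.pair s t := by
  have : (D.L.restrictAppIso D.σ.hom U).inv (r • t) = D.pullFun r • (D.L.restrictAppIso D.σ.hom U).inv t :=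
    smul_restrictAppIso_inv_apply _ _ _ _ _
  unfold pair toRing
  rw [this, tmul_smul, Scheme.Modules.Hom.app_smul]; rfl

lemma map_app {f : M ⟶ N} (i : V ⟶ U) (x : Γ(M, U)) :
    N.presheaf.map i.op (f.app U x) = f.app V (M.presheaf.map i.op x) :=
  (PresheafOfModules.naturality_apply f.val i.op x).symm

lemma map_pair (i : V ⟶ U) (s : Γ(D.L, U)) (t) : Y.presheaf.map i.op (D.pair s t) =
    D.pair (D.L.presheaf.map i.op s) (D.L.presheaf.map (D.imgMap i).op t) := by
  refine (map_app (f := D.φ) i _).trans ?_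
  rw [map_tmul]
  rfl

lemma tw_add_left (s s' : Γ(D.L, U)) (t : Γ(M, D.img U)) : D.tw (s + s') t = D.tw s t + D.tw s' t := add_tmul _ _ _

lemma tw_add_right (s : Γ(D.L, U)) (t t' : Γ(M, D.img U)) : D.tw s (t + t') = D.tw s t + D.tw s t' := tmul_add _ _ _

lemma tw_smul_left (r : Γ(Y, U)) (s : Γ(D.L, U)) (t : Γ(M, D.img U)) : D.tw (r • s) t = r • D.tw s t := smul_tmul _ _ _

lemma tw_smul_right (r : Γ(Y, D.img U)) (s : Γ(D.L, U)) (t : Γ(M, D.img U)) :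
    D.tw s (r • t) = D.pullFun r • D.tw s t := by
  have : (M.restrictAppIso D.σ.hom U).inv (r • t) = D.pullFun r • (M.restrictAppIso D.σ.hom U).inv t :=
    smul_restrictAppIso_inv_apply _ _ _ _ _
  unfold tw
  rw [this, tmul_smul]
  rfl

lemma map_tw (i : V ⟶ U) (s : Γ(D.L, U)) (t : Γ(M, D.img U)) : (D.twist.obj M).presheaf.map i.op (D.tw s t) =
    D.tw (D.L.presheaf.map i.op s) (M.presheaf.map (D.imgMap i).op t) := map_tmul _ _ _

lemma twist_map_tw (f : M ⟶ N) (s : Γ(D.L, U)) (t : Γ(M, D.img U)) : (D.twist.map f).app U (D.tw s t) =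
    D.tw s (f.app _ t) := tensorLeft_map_tmul _ _ _

lemma map_sqRes (i : V ⟶ U) (t : Γ(M, D.img (D.img U))) : M.presheaf.map i.op (D.sqRes M t) =
    D.sqRes M (M.presheaf.map (D.imgMap (D.imgMap i)).op t) := by
  unfold sqRes
  simp only [← ConcreteCategory.comp_apply, ← Functor.map_comp]
  rfl

lemma pullFun_pullFun (r : Γ(Y, D.img (D.img U))) :
    D.pullFun (D.pullFun r) = Y.presheaf.map (eqToHom (D.img_img U).symm).op r := by
  unfold pullFun
  rw [← ConcreteCategory.comp_apply, Scheme.Hom.appIso_hom', Scheme.Hom.appIso_hom', Scheme.Hom.appLE_comp_appLE]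
  have (f : Y ⟶ Y) (hf : f = 𝟙 Y) (e : U ≤ f ⁻¹ᵁ (D.img (D.img U))) :
      f.appLE _ _ e = Y.presheaf.map (eqToHom (D.img_img U).symm).op := by
    subst hf
    simp
    rfl
  rw [this _ D.σ_sq]

lemma sqRes_smul (r : Γ(Y, D.img (D.img U))) (t : Γ(M, D.img (D.img U))) :
    D.sqRes M (r • t) = D.pullFun (D.pullFun r) • D.sqRes M t := by
  rw [pullFun_pullFun]
  exact Scheme.Modules.map_smul _ _ _ _

lemma sqRes_add (t t' : Γ(M, D.img (D.img U))) :
    D.sqRes M (t + t') = D.sqRes M t + D.sqRes M t' := map_add _ _ _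

lemma app_sqRes (f : M ⟶ N) (t : Γ(M, D.img (D.img U))) :
    f.app U (D.sqRes M t) = D.sqRes N (f.app _ t) := (map_app _ _).symm

lemma pullFun_inv (r : Γ(Y, U)) : D.pullFun ((D.σ.hom.appIso U).inv r) = r := by
  unfold pullFun
  rw [← ConcreteCategory.comp_apply, Iso.inv_hom_id]
  rfl

lemma sqRes_tw (s : Γ(D.L, D.img (D.img U))) (t : Γ(M, D.img (D.img (D.img U)))) :
    D.sqRes (D.twist.obj M) (D.tw s t) = D.tw (D.sqRes D.L s) (D.sqRes M t) :=
  D.map_tw _ _ _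

/-- The presheaf tensor product of `L` and `σ^* M`. -/
abbrev P (M : Y.Modules) : Y.PresheafOfModules := presheafTensor D.L (M.restrict D.σ.hom)

/-- The map `s ⊗ s' ⊗ t ↦ φ(s ⊗ σ^* s') t` before sheafification. -/
def bmap (M : Y.Modules) (s : Γ(D.L, U)) : (D.P M).obj (op (D.img U)) →+ Γ(M, U) :=
  show TensorProduct Γ(Y, D.img U) Γ(D.L, D.img U) Γ(M.restrict D.σ.hom, D.img U) →+ Γ(M, U) from
  TensorProduct.liftAddHom
    (AddMonoidHom.mk' (fun s' => AddMonoidHom.mk'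
      (fun t => D.pair s s' • D.sqRes M ((M.restrictAppIso D.σ.hom (D.img U)).hom t))
      (fun t t' => by rw [map_add, sqRes_add, smul_add]))
      (fun s' s'' => by ext t; simp [pair_add_right, add_smul]))
    (fun r s' t => by
      change D.pair s (r • s') • _ = D.pair s s' • D.sqRes M
        ((M.restrictAppIso D.σ.hom (D.img U)).hom (r • t))
      rw [pair_smul_right]
      erw [smul_restrictAppIso_hom_apply]
      erw [sqRes_smul]
      rw [pullFun_inv, mul_comm, mul_smul])

/-- The identification `(σ^* M)(U) = M(σ(U))`. -/
def secR (t : Γ(M.restrict D.σ.hom, U)) : Γ(M, D.img U) := (M.restrictAppIso D.σ.hom U).hom t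

lemma bmap_ptmul (s : Γ(D.L, U)) (s' : Γ(D.L, D.img U)) (t : Γ(M.restrict D.σ.hom, D.img U)) :
    D.bmap M s (ptmul s' t) = D.pair s s' • D.sqRes M (D.secR t) :=
  rfl

lemma P_induction {C : (D.P M).obj (op U) → Prop}
    (tmul : ∀ s t, C (ptmul s t)) (add : ∀ x y, C x → C y → C (x + y)) (q) : C q :=
  presheafTensor_induction tmul add q

lemma bmap_add (s s' : Γ(D.L, U)) (q) : D.bmap M (s + s') q = D.bmap M s q + D.bmap M s' q := by
  induction q using D.P_induction with
  | tmul a b => simp only [bmap_ptmul, pair_add_left, add_smul]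
  | add x y hx hy => rw [map_add, map_add, map_add, hx, hy]; abel

lemma bmap_smul_left (r : Γ(Y, U)) (s : Γ(D.L, U)) (q) : D.bmap M (r • s) q = r • D.bmap M s q := by
  induction q using D.P_induction with
  | tmul a b => simp only [bmap_ptmul, pair_smul_left, mul_smul]
  | add x y hx hy => rw [map_add, map_add, smul_add, hx, hy]

lemma bmap_smul_right (r : Γ(Y, D.img U)) (s : Γ(D.L, U)) (q : (D.P M).obj (op (D.img U))) :
    D.bmap M s (show (D.P M).obj (op (D.img U)) from HSMul.hSMul (α := Y.ringCatSheaf.obj.obj (op (D.img U))) r q) = D.pullFun r • D.bmap M s q := by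
  induction q using D.P_induction with
  | tmul a b =>
    refine Eq.trans ?_ ((D.bmap_ptmul s (r • a) b).trans ?_)
    · rfl
    · rw [pair_smul_right, mul_smul]; rfl
  | add x y hx hy => rw [map_add, smul_add, ← hx, ← hy, ← map_add]; congr 1; exact smul_add (A := (D.P M).obj (op (D.img U))) (M := Y.ringCatSheaf.obj.obj (op (D.img U)))  r x y

lemma map_bmap (i : V ⟶ U) (s : Γ(D.L, U)) (q) : M.presheaf.map i.op (D.bmap M s q) =
    D.bmap M (D.L.presheaf.map i.op s) (pres _ _ (D.imgMap i) q) := by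
  induction q using D.P_induction with
  | tmul a b =>
    rw [bmap_ptmul, Scheme.Modules.map_smul, map_pair, map_sqRes, pres_ptmul, bmap_ptmul]
    rfl
  | add x y hx hy => simp only [map_add, hx, hy]

lemma bmap_congr (s : Γ(D.L, U)) (q q' : (D.P M).obj (op (D.img U)))
    (h : toTensorHom _ _ _ q = toTensorHom _ _ _ q') : D.bmap M s q = D.bmap M s q' := by
  refine section_ext _ _ _ fun p hp => ?_
  obtain ⟨W, i, hW, e⟩ := local_inj q q' h (D.σ.hom p) ⟨p, hp, rfl⟩
  have hj : D.σ.hom ⁻¹ᵁ W ≤ U := by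
    have := Scheme.Hom.preimage_mono D.σ.hom (leOfHom i)
    rwa [img, Scheme.Hom.preimage_image_eq] at this
  refine ⟨D.σ.hom ⁻¹ᵁ W, homOfLE hj, hW, ?_⟩
  rw [map_bmap, map_bmap]
  have hk : D.img (D.σ.hom ⁻¹ᵁ W) ≤ W := Scheme.Hom.image_preimage_le _ _
  have e' := congrArg (pres _ _ (homOfLE hk)) e
  rw [pres_pres i _ (D.imgMap (homOfLE hj)), pres_pres i _ (D.imgMap (homOfLE hj))] at e'
  exact congrArg _ e'

/-- The canonical map from the presheaf tensor product to `L_σ ⊗ M`. -/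
def toTwist (M : Y.Modules) (U : Y.Opens) : (D.P M).obj (op U) →+ Γ(D.twist.obj M, U) :=
  toTensorHom D.L (M.restrict D.σ.hom) U

lemma map_toTwist (i : V ⟶ U) (q : (D.P M).obj (op U)) :
    (D.twist.obj M).presheaf.map i.op (D.toTwist M U q) = D.toTwist M V (pres _ _ i q) :=
  map_toTensorHom _ _

lemma exists_q (x : Γ(D.twist.obj M, D.img U)) (p : Y) (hp : p ∈ U) :
    ∃ (V : Y.Opens) (i : V ⟶ U), p ∈ V ∧ ∃ q : (D.P M).obj (op (D.img V)),
      D.toTwist M _ q = (D.twist.obj M).presheaf.map (D.imgMap i).op x := by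
  obtain ⟨W, i, hW, q, hq⟩ := exists_local_lift x (D.σ.hom p) ⟨p, hp, rfl⟩
  have hj : D.σ.hom ⁻¹ᵁ W ≤ U := by
    have := Scheme.Hom.preimage_mono D.σ.hom (leOfHom i)
    rwa [img, Scheme.Hom.preimage_image_eq] at this
  have hk : D.img (D.σ.hom ⁻¹ᵁ W) ≤ W := Scheme.Hom.image_preimage_le _ _
  refine ⟨D.σ.hom ⁻¹ᵁ W, homOfLE hj, hW, pres _ _ (homOfLE hk) q, ?_⟩
  have hq : D.toTwist M W q = (D.twist.obj M).presheaf.map i.op x := hq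
  rw [← map_toTwist, hq]
  exact map_map _ _ _ _ _

lemma restrict_q {i : V ⟶ U} {W : Y.Opens} (j : W ⟶ V) {k : W ⟶ U} {x : Γ(D.twist.obj M, D.img U)}
    {q : (D.P M).obj (op (D.img V))}
    (hq : D.toTwist M _ q = (D.twist.obj M).presheaf.map (D.imgMap i).op x) :
    D.toTwist M _ (pres _ _ (D.imgMap j) q) =
      (D.twist.obj M).presheaf.map (D.imgMap k).op x := by
  rw [← map_toTwist, hq]
  exact map_map _ _ _ _ _

lemma exists_th (s : Γ(D.L, U)) (x : Γ(D.twist.obj M, D.img U)) :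
    ∃ y : Γ(M, U), ∀ (V : Y.Opens) (i : V ⟶ U) (q : (D.P M).obj (op (D.img V))),
      D.toTwist M _ q = (D.twist.obj M).presheaf.map (D.imgMap i).op x →
        M.presheaf.map i.op y = D.bmap M (D.L.presheaf.map i.op s) q := by
  have := exists_glue M U (fun V y' => ∃ (i : V ⟶ U) (q : (D.P M).obj (op (D.img V))),
      D.toTwist M _ q = (D.twist.obj M).presheaf.map (D.imgMap i).op x ∧
        y' = D.bmap M (D.L.presheaf.map i.op s) q)
    (by
      rintro V W j y ⟨i, q, hq, rfl⟩
      refine ⟨j ≫ i, pres _ _ (D.imgMap j) q, D.restrict_q j hq, ?_⟩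
      rw [map_bmap, map_map _ i j (j ≫ i)])
    (by
      rintro V y y' ⟨i, q, hq, rfl⟩ ⟨i', q', hq', rfl⟩
      obtain rfl := Subsingleton.elim i i'
      exact D.bmap_congr _ _ _ (hq.trans hq'.symm))
    (by
      intro p hp
      obtain ⟨V, i, hV, q, hq⟩ := D.exists_q x p hp
      exact ⟨V, i, hV, _, i, q, hq, rfl⟩)
  obtain ⟨y, hy⟩ := this
  exact ⟨y, fun V i q h => hy V i _ ⟨i, q, h, rfl⟩⟩

/-- The contraction of `s ∈ L(U)` with a section of `L_σ ⊗ M` over `σ(U)` by `φ`. -/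
def th (s : Γ(D.L, U)) (x : Γ(D.twist.obj M, D.img U)) : Γ(M, U) := (D.exists_th s x).choose

lemma th_spec (s : Γ(D.L, U)) (x : Γ(D.twist.obj M, D.img U)) (i : V ⟶ U)
    (q : (D.P M).obj (op (D.img V)))
    (hq : D.toTwist M _ q = (D.twist.obj M).presheaf.map (D.imgMap i).op x) :
    M.presheaf.map i.op (D.th s x) = D.bmap M (D.L.presheaf.map i.op s) q :=
  (D.exists_th s x).choose_spec V i q hq

lemma th_add_left (s s' : Γ(D.L, U)) (x : Γ(D.twist.obj M, D.img U)) :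
    D.th (s + s') x = D.th s x + D.th s' x := by
  refine section_ext _ _ _ fun p hp => ?_
  obtain ⟨V, i, hV, q, hq⟩ := D.exists_q x p hp
  refine ⟨V, i, hV, ?_⟩
  rw [map_add, D.th_spec _ _ i q hq, D.th_spec _ _ i q hq, D.th_spec _ _ i q hq, map_add, bmap_add]

lemma th_add_right (s : Γ(D.L, U)) (x x' : Γ(D.twist.obj M, D.img U)) :
    D.th s (x + x') = D.th s x + D.th s x' := by
  refine section_ext _ _ _ fun p hp => ?_
  obtain ⟨V, i, hV, q, hq⟩ := D.exists_q x p hp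
  obtain ⟨V', i', hV', q', hq'⟩ := D.exists_q x' p hp
  refine ⟨V ⊓ V', homOfLE (inf_le_left.trans (leOfHom i)), ⟨hV, hV'⟩, ?_⟩
  have h := D.restrict_q (homOfLE inf_le_left : V ⊓ V' ⟶ V)
    (k := homOfLE (inf_le_left.trans (leOfHom i))) hq
  have h' := D.restrict_q (homOfLE inf_le_right : V ⊓ V' ⟶ V')
    (k := homOfLE (inf_le_left.trans (leOfHom i))) hq'
  rw [map_add, D.th_spec _ _ _ _ h, D.th_spec _ _ _ _ h', ← map_add, D.th_spec _ _ _ _]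
  rw [map_add, map_add, h, h']

lemma th_smul_left (r : Γ(Y, U)) (s : Γ(D.L, U)) (x : Γ(D.twist.obj M, D.img U)) :
    D.th (r • s) x = r • D.th s x := by
  refine section_ext _ _ _ fun p hp => ?_
  obtain ⟨V, i, hV, q, hq⟩ := D.exists_q x p hp
  refine ⟨V, i, hV, ?_⟩
  rw [Scheme.Modules.map_smul, D.th_spec _ _ i q hq, D.th_spec _ _ i q hq, Scheme.Modules.map_smul,
    bmap_smul_left]

lemma map_pullFun (i : V ⟶ U) (r : Γ(Y, D.img U)) : Y.presheaf.map i.op (D.pullFun r) =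
    D.pullFun (Y.presheaf.map (D.imgMap i).op r) :=
  (congrArg (fun g => g.hom r) (D.σ.hom.appIso_hom_naturality i.op)).symm

lemma th_smul_right (r : Γ(Y, D.img U)) (s : Γ(D.L, U)) (x : Γ(D.twist.obj M, D.img U)) :
    D.th s (r • x) = D.pullFun r • D.th s x := by
  refine section_ext _ _ _ fun p hp => ?_
  obtain ⟨V, i, hV, q, hq⟩ := D.exists_q x p hp
  refine ⟨V, i, hV, ?_⟩
  rw [Scheme.Modules.map_smul, D.th_spec _ _ i q hq, map_pullFun, ← bmap_smul_right,
    D.th_spec _ _ i]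
  rw [Scheme.Modules.map_smul, ← hq]
  exact ((toTensor D.L (M.restrict D.σ.hom)).app (op (D.img V))).hom.map_smul _ q

lemma map_th (i : V ⟶ U) (s : Γ(D.L, U)) (x : Γ(D.twist.obj M, D.img U)) :
    M.presheaf.map i.op (D.th s x) =
      D.th (D.L.presheaf.map i.op s) ((D.twist.obj M).presheaf.map (D.imgMap i).op x) := by
  refine section_ext _ _ _ fun p hp => ?_
  obtain ⟨W, j, hW, q, hq⟩ := D.exists_q ((D.twist.obj M).presheaf.map (D.imgMap i).op x) p hp
  refine ⟨W, j, hW, ?_⟩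
  rw [D.th_spec _ _ j q hq, map_map _ i j (j ≫ i), map_map _ i j (j ≫ i), D.th_spec _ _ _ q]
  rw [hq]
  exact map_map _ _ _ _ _

lemma th_tw (s : Γ(D.L, U)) (s' : Γ(D.L, D.img U)) (t : Γ(M, D.img (D.img U))) :
    D.th s (D.tw s' t) = D.pair s s' • D.sqRes M t := by
  have := D.th_spec s (D.tw s' t) (𝟙 U) (ptmul s' ((M.restrictAppIso D.σ.hom _).inv t)) (by
    have : D.imgMap (𝟙 U) = 𝟙 _ := rfl
    rw [this, op_id, CategoryTheory.Functor.map_id]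
    rfl)
  rw [op_id, CategoryTheory.Functor.map_id, CategoryTheory.Functor.map_id] at this
  exact this

/-- The contraction by `φ` as a bilinear map. -/
def thBil (M : Y.Modules) : Bil D.L ((D.twist.obj M).restrict D.σ.hom) M where
  toFun U s x := D.th s (D.secR x)
  add_left _ _ _ _ := D.th_add_left _ _ _
  add_right _ _ _ _ := D.th_add_right _ _ _
  smul_left _ _ _ _ := D.th_smul_left _ _ _
  smul_right U r s x := by
    refine Eq.trans ?_ ((D.th_smul_right ((D.σ.hom.appIso U).inv r) s (D.secR x)).trans ?_)
    · rfl
    · rw [pullFun_inv]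
  map _ _ _ := D.map_th _ _ _

/-- The morphism `φ ⊗ 1 : L_σ ⊗ L_σ ⊗ M ⟶ M`. -/
def thetaApp (M : Y.Modules) : D.twist.obj (D.twist.obj M) ⟶ M := (D.thBil M).lift

lemma thetaApp_tw (s : Γ(D.L, U)) (x : Γ(D.twist.obj M, D.img U)) :
    (D.thetaApp M).app U (D.tw s x) = D.th s x := (D.thBil M).lift_tmul _ _

lemma twist_hom_ext {f g : D.twist.obj M ⟶ N}
    (h : ∀ (U : Y.Opens) (s : Γ(D.L, U)) (t : Γ(M, D.img U)), f.app U (D.tw s t) = g.app U (D.tw s t)) :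
    f = g := tensor_hom_ext h

lemma twist_twist_hom_ext {f g : D.twist.obj (D.twist.obj M) ⟶ N}
    (h : ∀ (U : Y.Opens) (s : Γ(D.L, U)) (s' : Γ(D.L, D.img U)) (t : Γ(M, D.img (D.img U))),
      f.app U (D.tw s (D.tw s' t)) = g.app U (D.tw s (D.tw s' t))) :
    f = g := by
  refine D.twist_hom_ext fun U s x => section_ext _ _ _ fun p hp => ?_
  obtain ⟨V, i, hV, q, hq⟩ := D.exists_q x p hp
  refine ⟨V, i, hV, ?_⟩
  rw [map_app, map_app, map_tw, ← hq]
  generalize D.L.presheaf.map i.op s = s₁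
  clear hq
  induction q using D.P_induction with
  | tmul a b => exact h _ _ a (D.secR b)
  | add x y hx hy =>
    rw [map_add, tw_add_right, map_add, map_add, hx, hy]

lemma twist_twist_twist_hom_ext {f g : D.twist.obj (D.twist.obj (D.twist.obj M)) ⟶ N}
    (h : ∀ (U : Y.Opens) (s : Γ(D.L, U)) (s' : Γ(D.L, D.img U)) (s'' : Γ(D.L, D.img (D.img U)))
      (t : Γ(M, D.img (D.img (D.img U)))),
      f.app U (D.tw s (D.tw s' (D.tw s'' t))) = g.app U (D.tw s (D.tw s' (D.tw s'' t)))) :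
    f = g := by
  refine D.twist_twist_hom_ext fun U s s' x => section_ext _ _ _ fun p hp => ?_
  obtain ⟨V, i, hV, q, hq⟩ := D.exists_q x (D.σ.hom p) ⟨p, hp, rfl⟩
  have hj : D.σ.hom ⁻¹ᵁ V ≤ U := by
    have := Scheme.Hom.preimage_mono D.σ.hom (leOfHom i)
    rwa [img, Scheme.Hom.preimage_image_eq] at this
  have hk : D.img (D.σ.hom ⁻¹ᵁ V) ≤ V := Scheme.Hom.image_preimage_le _ _
  refine ⟨D.σ.hom ⁻¹ᵁ V, homOfLE hj, hV, ?_⟩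
  have hq' := D.restrict_q (homOfLE hk) (k := D.imgMap (homOfLE hj)) hq
  rw [map_app, map_app, map_tw, map_tw, ← hq']
  generalize D.L.presheaf.map _ s = s₁
  generalize D.L.presheaf.map _ s' = s₂
  generalize pres _ _ _ q = q'
  induction q' using D.P_induction with
  | tmul a b => exact h _ _ _ a (D.secR b)
  | add x y hx hy =>
    rw [map_add, tw_add_right, tw_add_right, map_add, map_add, hx, hy]

/-- The natural transformation `φ ⊗ 1 : L_σ ⊗ L_σ ⊗ M ⟶ M`; it is determined by
`s ⊗ σ^* (s' ⊗ σ^* t) ↦ φ(s ⊗ σ^* s') t`, see `theta_app_tw_tw`. -/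
def theta : D.twist ⋙ D.twist ⟶ 𝟭 Y.Modules where
  app M := D.thetaApp M
  naturality M N f := by
    refine D.twist_twist_hom_ext fun U s s' t => ?_
    change (D.thetaApp N).app U ((D.twist.map (D.twist.map f)).app U (D.tw s (D.tw s' t))) =
      f.app U ((D.thetaApp M).app U (D.tw s (D.tw s' t)))
    rw [twist_map_tw, twist_map_tw, thetaApp_tw, thetaApp_tw, th_tw, th_tw, Scheme.Modules.Hom.app_smul, app_sqRes]

lemma theta_app_tw_tw (s : Γ(D.L, U)) (s' : Γ(D.L, D.img U)) (t : Γ(M, D.img (D.img U))) :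
    (D.theta.app M).app U (D.tw s (D.tw s' t)) = D.pair s s' • D.sqRes M t :=
  (D.thetaApp_tw _ _).trans (D.th_tw _ _ _)

/-- The overlap condition: the maps `φ ⊗ 1` and `1 ⊗ φ` from `L_σ ⊗ L_σ ⊗ L_σ` to `L_σ` are
equal, where the right multiplication on `L_σ` by a function `f` is multiplication by `σ^* f`. -/
def Overlap : Prop := ∀ (U : Y.Opens) (s : Γ(D.L, U)) (s' : Γ(D.L, D.img U)) (s'' : Γ(D.L, D.img (D.img U))),
  D.pair s s' • D.sqRes D.L s'' = D.pullFun (D.pair s' s'') • s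

lemma theta_overlap (h : D.Overlap) (M : Y.Modules) :
    D.twist.map (D.theta.app M) = D.theta.app (D.twist.obj M) := by
  refine D.twist_twist_twist_hom_ext fun U s s' s'' t => ?_
  rw [twist_map_tw, theta_app_tw_tw, theta_app_tw_tw, tw_smul_right, sqRes_tw, ← tw_smul_left,
    ← tw_smul_left, h]

instance : D.twist.Additive where
  map_add {M N f g} := by
    refine D.twist_hom_ext fun U s t => ?_
    rw [twist_map_tw]
    simp only [Scheme.Modules.Hom.add_app]
    change D.tw s (f.app _ t + g.app _ t) = (D.twist.map f).app U (D.tw s t) + (D.twist.map g).app U (D.tw s t)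
    rw [twist_map_tw, twist_map_tw, tw_add_right]

/-- The cyclic algebra `A = 𝒪_Y ⊕ L_σ` with multiplication `L_σ ⊗ L_σ ⟶ 𝒪_Y` given by `φ`. As an
algebra in `𝒪_Y`-bimodules it is given by the monad `M ↦ A ⊗ M = M ⊕ L_σ ⊗ M` on `𝒪_Y`-modules;
left `A`-modules are the modules over this monad. -/
def algebra (h : D.Overlap) : Monad Y.Modules :=
  quadraticMonad D.twist D.theta (D.theta_overlap h)

end CyclicDatum

/-- `M` is a vector bundle of rank `r`: locally, it has a basis consisting of `r` sections. -/
def IsVectorBundle (r : ℕ) (M : Y.Modules) : Prop :=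
  ∀ x : Y, ∃ (U : Y.Opens) (_ : x ∈ U) (e : Fin r → Γ(M, U)), ∀ (V : Y.Opens) (i : V ⟶ U),
    Function.Bijective fun c : Fin r → Γ(Y, V) => ∑ j, c j • M.presheaf.map i.op (e j)

/-- A rank two bundle is split if it is a direct sum of two line bundles. -/
def IsSplit (M : Y.Modules) : Prop :=
  ∃ N N' : Y.Modules, IsVectorBundle 1 N ∧ IsVectorBundle 1 N' ∧ Nonempty (M ≅ N ⊞ N')

/-- `L` is a 1-coboundary for the action of `⟨σ⟩` on `Pic Y`: it is isomorphic to
`N ⊗ (σ^* N)⁻¹` for a line bundle `N`, that is, `L ⊗ σ^* N ≅ N`. -/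
def CyclicDatum.IsCoboundary (D : CyclicDatum Y) : Prop :=
  ∃ N : Y.Modules, IsVectorBundle 1 N ∧ Nonempty (tensor D.L (N.restrict D.σ.hom) ≅ N)

section Variety

variable {k : Type u} [Field k] (p : Y ⟶ Spec (CommRingCat.of k))

/-- A constant `c ∈ k` as a function on the open subset `U` of the `k`-scheme `Y`. -/
def constant (c : k) (U : Y.Opens) : Γ(Y, U) :=
  Y.presheaf.map (homOfLE le_top : U ⟶ ⊤).op
    (p.appTop ((Scheme.ΓSpecIso (CommRingCat.of k)).inv c))

/-- `M` is simple: its endomorphism ring is `k`, that is, every endomorphism of `M` is the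
multiplication by a unique constant. -/
def IsSimple (M : Y.Modules) : Prop :=
  ∀ f : M ⟶ M, ∃! c : k, ∀ (U : Y.Opens) (x : Γ(M, U)), f.app U x = constant p c U • x

attribute [local instance] MvPolynomial.gradedAlgebra in
/-- The `k`-scheme `Y` is projective: it is isomorphic over `k` to a closed subscheme of a
projective space `ℙⁿ = Proj k[x₀, …, xₙ]`. -/
def IsProjective : Prop :=
  ∃ (n : ℕ) (i : Y ⟶ Proj (MvPolynomial.homogeneousSubmodule (Fin (n + 1)) k)),
    IsClosedImmersion i ∧
      i ≫ Proj.toSpecZero (MvPolynomial.homogeneousSubmodule (Fin (n + 1)) k) ≫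
        Spec.map (CommRingCat.ofHom
          (algebraMap k (MvPolynomial.homogeneousSubmodule (Fin (n + 1)) k 0))) = p

end Variety

end CyclicCover

end

/-!
A left module over the cyclic algebra `A = 𝒪_Y ⊕ L_σ` on `M` is the same as a map
`a : F M ⟶ M`, where `F = L_σ ⊗ -`, with `F a ≫ a = θ`, where `θ : F F M ⟶ M` is the contraction by
`φ`. Since `φ` is an isomorphism and `L` is a line bundle, `θ` is an isomorphism
(`CyclicDatum.isIso_theta`): if `e` and `e'` are local bases of `L` near a point and near its image
under `σ`, then each section of `F F M` is uniquely `e ⊗ σ^* (e' ⊗ σ^* t)`, and `θ` maps it to `t`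
times the unit `φ(e ⊗ σ^* e')`. As a consequence, every action `a` is an isomorphism `F M ≅ M`.

Let `M = N ⊕ N'` be split. The endomorphisms of a line bundle are the global functions on `Y`, which
form a field as `Y` is projective and integral. Write `a` as a matrix. The composite of `F a₁₁` and
`a₁₁` on `N` is thus zero or an isomorphism. In the latter case `a₁₁ : F N ≅ N`, and `L` is a
coboundary. Hence, the off-diagonal components compose to isomorphisms on `N` and on `N'`, so that
`F N ⟶ N'` is an isomorphism, and `A ⊗ N = N ⊕ F N ⟶ M` is an isomorphism of modules
(`ModuleStructure.nonempty_free_iso`). The free module on `N` does not depend on the action.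

Let `M` be simple, and `g : F M ≅ M`. Then `F g ≫ g` is a constant times `θ`, and can be made equal to
`θ` by dividing `g` by a square root of the constant. Two actions differ by a constant of square one,
and `a ≠ -a`. An isomorphism of modules is a constant, hence intertwines an action only with itself;
here `F` is `k`-linear as `σ` is a morphism over `k`.
-/

noncomputable section

namespace CyclicCover

/-! ### Modules over a quadratic monad -/

section Abstract

variable {C : Type*} [Category* C]

/-- If both composites `F f ≫ g` and `F g ≫ f` are isomorphisms, then `g` is a split epimorphism
and `F g` is both a split epimorphism and a split monomorphism. -/
lemma isIso_of_isIso_map_comp (F : C ⥤ C) {A B : C} (f : F.obj A ⟶ B) (g : F.obj B ⟶ A)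
    (h : IsIso (F.map f ≫ g)) (h' : IsIso (F.map g ≫ f)) : IsIso f := by
  have hg : IsSplitEpi g := ⟨⟨inv (F.map f ≫ g) ≫ F.map f, by simp⟩⟩
  have hFg : IsSplitMono (F.map g) := ⟨⟨f ≫ inv (F.map g ≫ f), by rw [← Category.assoc]; simp⟩⟩
  have : IsIso (F.map g) := isIso_of_epi_of_isSplitMono _
  exact IsIso.of_isIso_comp_left (F.map g) f

/-- The morphism from the free algebra on `N` defined by a map from `N` to an algebra. -/
def freeDesc {T : Monad C} (B : T.Algebra) {N : C} (f : N ⟶ B.A) : T.free.obj N ⟶ B where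
  f := T.map f ≫ B.a
  h := by
    have := T.μ.naturality f
    dsimp at this
    change T.map (T.map f ≫ B.a) ≫ B.a = T.μ.app N ≫ T.map f ≫ B.a
    rw [Functor.map_comp, Category.assoc, ← B.assoc, reassoc_of% this]

variable [Preadditive C]

/-- Among two endomorphisms of `N` with sum the identity, one is an isomorphism: the endomorphism
ring of `N` is local (or zero). -/
def HasLocalEnd (N : C) : Prop := ∀ b b' : N ⟶ N, b + b' = 𝟙 N → IsIso b ∨ IsIso b'

variable [HasBinaryBiproducts C] {F : C ⥤ C} [F.Additive]
  {θ : F ⋙ F ⟶ 𝟭 C} {h : ∀ X, F.map (θ.app X) = θ.app (F.obj X)}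

/-- The component `F M ⟶ M` of the action of the quadratic monad on a module. -/
def ModuleStructure.twistAct {M : C} (S : ModuleStructure (quadraticMonad F θ h) M) :
    F.obj M ⟶ M :=
  (biprod.inr : F.obj M ⟶ M ⊞ F.obj M) ≫ S.act

lemma ModuleStructure.act_eq {M : C} (S : ModuleStructure (quadraticMonad F θ h) M) :
    S.act = biprod.desc (𝟙 M) S.twistAct := by
  apply biprod.hom_ext'
  · rw [biprod.inl_desc]
    exact S.unit
  · rw [biprod.inr_desc]
    rfl

lemma ModuleStructure.ext_twistAct {M : C} {S S' : ModuleStructure (quadraticMonad F θ h) M}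
    (e : S.twistAct = S'.twistAct) : S = S' := by
  have := S.act_eq.trans ((congrArg _ e).trans S'.act_eq.symm)
  cases S
  cases S'
  cases this
  rfl

lemma ModuleStructure.map_twistAct_comp {M : C}
    (S : ModuleStructure (quadraticMonad F θ h) M) :
    F.map S.twistAct ≫ S.twistAct = θ.app M := by
  have e : biprod.desc (𝟙 (M ⊞ F.obj M))
      (F.map biprod.fst ≫ biprod.inr + F.map biprod.snd ≫ θ.app M ≫ biprod.inl) ≫
        biprod.desc (𝟙 M) S.twistAct =
      biprod.map (biprod.desc (𝟙 M) S.twistAct) (F.map (biprod.desc (𝟙 M) S.twistAct)) ≫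
        biprod.desc (𝟙 M) S.twistAct := by
    rw [← S.act_eq]
    exact S.assoc
  have e' := congrArg
    (fun g => F.map (biprod.inr : F.obj M ⟶ M ⊞ F.obj M) ≫ biprod.inr ≫ g) e
  rw [biprod.inr_map_assoc, biprod.inr_desc_assoc, biprod.inr_desc] at e'
  simp only [Preadditive.add_comp, Preadditive.comp_add, Category.assoc, biprod.inl_desc,
    biprod.inr_desc, ← Functor.map_comp_assoc, biprod.inr_fst, biprod.inr_snd] at e'
  simpa using e'.symm

/-- The module structure on `M` defined by a map `a : F M ⟶ M` with `F a ≫ a = θ`. -/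
def ModuleStructure.mkTwist {M : C} (a : F.obj M ⟶ M) (ha : F.map a ≫ a = θ.app M) :
    ModuleStructure (quadraticMonad F θ h) M where
  act := biprod.desc (𝟙 M) a
  unit := by
    dsimp [quadraticMonad]
    exact biprod.inl_desc _ _
  assoc := by
    dsimp [quadraticMonad]
    apply biprod.hom_ext'
    · simp
    · rw [biprod.inr_desc_assoc, biprod.inr_map_assoc, biprod.inr_desc]
      simp only [Preadditive.add_comp, Category.assoc, biprod.inr_desc, biprod.inl_desc,
        Category.comp_id]
      rw [← ha, ← F.map_comp_assoc, ← Preadditive.add_comp, ← F.map_add]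
      congr 2
      apply biprod.hom_ext' <;> simp

@[simp]
lemma ModuleStructure.mkTwist_twistAct {M : C} (a : F.obj M ⟶ M) (ha : F.map a ≫ a = θ.app M) :
    (ModuleStructure.mkTwist (h := h) a ha).twistAct = a := biprod.inr_desc _ _

lemma ModuleStructure.twistAct_comp {M : C} {S S' : ModuleStructure (quadraticMonad F θ h) M}
    (f : S.toModule ⟶ S'.toModule) :
    F.map (show M ⟶ M from f.f) ≫ S'.twistAct = S.twistAct ≫ (show M ⟶ M from f.f) := by
  obtain ⟨g, hg⟩ := f
  change M ⟶ M at g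
  have e : biprod.map g (F.map g) ≫ biprod.desc (𝟙 M) S'.twistAct =
      biprod.desc (𝟙 M) S.twistAct ≫ g := by
    rw [← S.act_eq, ← S'.act_eq]
    exact hg
  have e' := congrArg (fun g => (biprod.inr : F.obj M ⟶ M ⊞ F.obj M) ≫ g) e
  rwa [biprod.inr_map_assoc, biprod.inr_desc, biprod.inr_desc_assoc] at e'

lemma ModuleStructure.isIso_twistAct [IsIso θ] {M : C}
    (S : ModuleStructure (quadraticMonad F θ h) M) : IsIso S.twistAct := by
  have : IsIso (F.map S.twistAct ≫ S.twistAct) := by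
    rw [S.map_twistAct_comp]
    infer_instance
  exact isIso_of_isIso_map_comp F _ _ this this

/-- The map `(1, 0; u, v)` between biproducts is an isomorphism if `v` is. -/
lemma isIso_desc_inl {N P Q : C} (u : P ⟶ N) (v : P ⟶ Q) [IsIso v] :
    IsIso (biprod.desc biprod.inl (biprod.lift u v) : N ⊞ P ⟶ N ⊞ Q) := by
  refine ⟨biprod.desc biprod.inl (biprod.lift (-(inv v ≫ u)) (inv v)), ?_, ?_⟩
  · apply biprod.hom_ext' <;> apply biprod.hom_ext <;>
      simp [biprod.lift_eq, Preadditive.add_comp]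
  · apply biprod.hom_ext' <;> apply biprod.hom_ext <;>
      simp [biprod.lift_eq, Preadditive.add_comp]

/-- If `M = N ⊕ N'` is a module, where `N` has local endomorphism ring and `F N ≇ N`, then the
diagonal component of the action on `N` contributes nothing invertible to `θ`, so the product of
the two off-diagonal components is invertible. -/
lemma isIso_offDiag [IsIso θ] {M N N' : C} (e : M ≅ N ⊞ N') (hN : HasLocalEnd N)
    (hFN : ¬ Nonempty (F.obj N ≅ N)) (a : F.obj M ⟶ M) (ha : F.map a ≫ a = θ.app M) :
    IsIso (F.map (F.map (biprod.inl ≫ e.inv) ≫ a ≫ e.hom ≫ biprod.snd) ≫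
      F.map (biprod.inr ≫ e.inv) ≫ a ≫ e.hom ≫ biprod.fst) := by
  set a₁ : F.obj N ⟶ N := F.map (biprod.inl ≫ e.inv) ≫ a ≫ e.hom ≫ biprod.fst with ha₁
  set a₂ := F.map (biprod.inl ≫ e.inv) ≫ a ≫ e.hom ≫ biprod.snd with ha₂
  set a₃ := F.map (biprod.inr ≫ e.inv) ≫ a ≫ e.hom ≫ biprod.fst with ha₃
  have key : F.map a₁ ≫ a₁ + F.map a₂ ≫ a₃ = θ.app N := by
    have h1 : e.hom ≫ biprod.fst ≫ biprod.inl ≫ e.inv + e.hom ≫ biprod.snd ≫ biprod.inr ≫ e.inv =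
        𝟙 M := by
      rw [← Preadditive.comp_add, ← Category.assoc biprod.fst, ← Category.assoc biprod.snd,
        ← Preadditive.add_comp, biprod.total]
      simp
    have h2 := θ.naturality (biprod.inl ≫ e.inv : N ⟶ M)
    dsimp at h2
    have h3 : θ.app N = F.map (F.map (biprod.inl ≫ e.inv)) ≫ θ.app M ≫ e.hom ≫ biprod.fst := by
      rw [reassoc_of% h2]; simp
    have h4 : F.map a = F.map (a ≫ (e.hom ≫ biprod.fst ≫ biprod.inl ≫ e.inv +
        e.hom ≫ biprod.snd ≫ biprod.inr ≫ e.inv)) := by rw [h1, Category.comp_id]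
    rw [h3, ← ha, h4, ha₁, ha₂, ha₃]
    simp only [Functor.map_comp, Functor.map_add, Preadditive.comp_add, Preadditive.add_comp,
      Category.assoc]
  have key' : inv (θ.app N) ≫ F.map a₁ ≫ a₁ + inv (θ.app N) ≫ F.map a₂ ≫ a₃ = 𝟙 N := by
    rw [← Preadditive.comp_add, key]
    exact IsIso.inv_hom_id _
  rcases hN _ _ key' with h1 | h1
  · have h2 : IsIso (F.map a₁ ≫ a₁) := IsIso.of_isIso_comp_left (inv (θ.app N)) _
    have := isIso_of_isIso_map_comp F a₁ a₁ h2 h2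
    exact (hFN ⟨asIso a₁⟩).elim
  · exact IsIso.of_isIso_comp_left (inv (θ.app N)) _

/-- A module over the quadratic monad with underlying object `N ⊕ N'`, where `N` and `N'` have local
endomorphism rings and are not fixed by `F`, is the free module on `N`. -/
lemma ModuleStructure.nonempty_free_iso [IsIso θ] {M N N' : C} (e : M ≅ N ⊞ N')
    (hN : HasLocalEnd N) (hN' : HasLocalEnd N') (hFN : ¬ Nonempty (F.obj N ≅ N))
    (hFN' : ¬ Nonempty (F.obj N' ≅ N')) (S : ModuleStructure (quadraticMonad F θ h) M) :
    Nonempty ((quadraticMonad F θ h).free.obj N ≅ S.toModule) := by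
  have h1 := isIso_offDiag e hN hFN _ S.map_twistAct_comp
  have h2 : IsIso (F.map (F.map (biprod.inr ≫ e.inv) ≫ S.twistAct ≫ e.hom ≫ biprod.fst) ≫
      F.map (biprod.inl ≫ e.inv) ≫ S.twistAct ≫ e.hom ≫ biprod.snd) := by
    have := isIso_offDiag (e ≪≫ biprod.braiding N N') hN' hFN' _ S.map_twistAct_comp
    have hl : (biprod.inl : N' ⟶ N' ⊞ N) ≫ biprod.lift biprod.snd biprod.fst = biprod.inr := by
      apply biprod.hom_ext <;> simp
    have hr : (biprod.inr : N ⟶ N' ⊞ N) ≫ biprod.lift biprod.snd biprod.fst = biprod.inl := by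
      apply biprod.hom_ext <;> simp
    simpa only [Iso.trans_hom, Iso.trans_inv, Category.assoc, biprod.braiding_hom,
      biprod.braiding_inv, reassoc_of% hl, reassoc_of% hr, biprod.lift_fst,
      biprod.lift_snd] using this
  have h3 := isIso_of_isIso_map_comp F _ _ h1 h2
  let f := freeDesc S.toModule (biprod.inl ≫ e.inv : N ⟶ M)
  have hf : biprod.map (biprod.inl ≫ e.inv) (F.map (biprod.inl ≫ e.inv)) ≫ S.act =
      biprod.desc biprod.inl
      (biprod.lift (F.map (biprod.inl ≫ e.inv) ≫ S.twistAct ≫ e.hom ≫ biprod.fst)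
        (F.map (biprod.inl ≫ e.inv) ≫ S.twistAct ≫ e.hom ≫ biprod.snd)) ≫ e.inv := by
    rw [S.act_eq, ← cancel_mono e.hom]
    apply biprod.hom_ext'
    · simp
    · apply biprod.hom_ext <;> simp
  have hf' : IsIso f.f := by
    have := isIso_desc_inl (F.map (biprod.inl ≫ e.inv) ≫ S.twistAct ≫ e.hom ≫ biprod.fst)
        (F.map (biprod.inl ≫ e.inv) ≫ S.twistAct ≫ e.hom ≫ biprod.snd)
    change IsIso (biprod.map (biprod.inl ≫ e.inv) (F.map (biprod.inl ≫ e.inv)) ≫ S.act)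
    rw [hf]
    infer_instance
  have := Monad.algebra_iso_of_iso _ f
  exact ⟨asIso f⟩

end Abstract

/-! ### Tensor products with line bundles -/

variable {X : Scheme.{u}} {F G : X.Modules} {U V : X.Opens}

/-- The section `e` of `F` over `U` is a basis of `F` restricted to `U`. -/
def IsFreeGenerator (e : Γ(F, U)) : Prop :=
  ∀ (V : X.Opens) (i : V ⟶ U), Function.Bijective fun c : Γ(X, V) => c • F.presheaf.map i.op e

lemma IsFreeGenerator.restrict {e : Γ(F, U)} (he : IsFreeGenerator e) (i : V ⟶ U) :
    IsFreeGenerator (F.presheaf.map i.op e) := by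
  intro W j
  rw [map_map F i j (j ≫ i)]
  exact he W (j ≫ i)

lemma IsFreeGenerator.bijective {e : Γ(F, U)} (he : IsFreeGenerator e) :
    Function.Bijective fun c : Γ(X, U) => c • e := by
  have := he U (𝟙 U)
  rw [op_id, CategoryTheory.Functor.map_id] at this
  exact this

lemma IsVectorBundle.exists_isFreeGenerator (hF : IsVectorBundle 1 F) (x : X) :
    ∃ (U : X.Opens) (_ : x ∈ U) (e : Γ(F, U)), IsFreeGenerator e := by
  obtain ⟨U, hx, e, he⟩ := hF x
  refine ⟨U, hx, e 0, fun V i => ?_⟩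
  have := (he V i).comp (Equiv.funUnique (Fin 1) Γ(X, V)).symm.bijective
  refine (congrArg Function.Bijective ?_).mp this
  funext c
  simp [Equiv.funUnique]

lemma IsFreeGenerator.ptmul_injective {e : Γ(F, U)} (he : IsFreeGenerator e) :
    Function.Injective (ptmul (G := G) e) := by
  intro t t' h
  let f : Γ(X, U) ≃ₗ[Γ(X, U)] Γ(F, U) :=
    LinearEquiv.ofBijective (LinearMap.toSpanSingleton Γ(X, U) Γ(F, U) e) he.bijective
  have hf : f.symm e = 1 := by
    rw [LinearEquiv.symm_apply_eq]
    exact (one_smul _ e).symm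
  have h' : TensorProduct.tmul Γ(X, U) e t = TensorProduct.tmul Γ(X, U) e t' := h
  have := congrArg
    (TensorProduct.lid Γ(X, U) Γ(G, U) ∘ LinearMap.rTensor Γ(G, U) f.symm.toLinearMap) h'
  simpa [hf] using this

lemma IsFreeGenerator.exists_ptmul {e : Γ(F, U)} (he : IsFreeGenerator e)
    (q : (presheafTensor F G).obj (op U)) : ∃ t, ptmul e t = q := by
  induction q using presheafTensor_induction with
  | tmul s t =>
    obtain ⟨c, rfl⟩ := he.bijective.2 s
    exact ⟨c • t, (TensorProduct.smul_tmul (R := Γ(X, U)) (M := Γ(F, U)) (N := Γ(G, U)) c e t).symm⟩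
  | add x y hx hy =>
    obtain ⟨t, rfl⟩ := hx
    obtain ⟨t', rfl⟩ := hy
    exact ⟨t + t', TensorProduct.tmul_add (R := Γ(X, U)) (M := Γ(F, U)) (N := Γ(G, U)) e t t'⟩

lemma IsFreeGenerator.tmul_injective {e : Γ(F, U)} (he : IsFreeGenerator e) :
    Function.Injective fun t : Γ(G, U) => tmul e t := by
  intro t t' h
  refine section_ext _ _ _ fun p hp => ?_
  obtain ⟨V, i, hV, h'⟩ := local_inj _ _ h p hp
  rw [pres_ptmul, pres_ptmul] at h'
  exact ⟨V, i, hV, (he.restrict i).ptmul_injective h'⟩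

/-- Locally, each section of `F ⊗ G` is of the form `e ⊗ t`, and the local sections `t` glue as they
are unique. -/
lemma IsFreeGenerator.tmul_bijective {e : Γ(F, U)} (he : IsFreeGenerator e) :
    Function.Bijective fun t : Γ(G, U) => tmul e t := by
  refine ⟨he.tmul_injective, fun x => ?_⟩
  have hex (p : X) (hp : p ∈ U) : ∃ (V : X.Opens) (i : V ⟶ U), p ∈ V ∧ ∃ t : Γ(G, V),
      tmul (F.presheaf.map i.op e) t = (tensor F G).presheaf.map i.op x := by
    obtain ⟨V, i, hV, q, hq⟩ := exists_local_lift x p hp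
    obtain ⟨t, rfl⟩ := (he.restrict i).exists_ptmul q
    exact ⟨V, i, hV, t, hq⟩
  obtain ⟨y, hy⟩ := exists_glue G U (fun V t => ∃ i : V ⟶ U,
      tmul (F.presheaf.map i.op e) t = (tensor F G).presheaf.map i.op x)
    (by
      rintro V W j t ⟨i, ht⟩
      refine ⟨j ≫ i, ?_⟩
      rw [← map_map F i j (j ≫ i), ← map_tmul, ht, map_map _ i j (j ≫ i)])
    (by
      rintro V t t' ⟨i, ht⟩ ⟨i', ht'⟩
      obtain rfl := Subsingleton.elim i i'
      exact (he.restrict i).tmul_injective (ht.trans ht'.symm))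
    (fun p hp => by
      obtain ⟨V, i, hV, t, ht⟩ := hex p hp
      exact ⟨V, i, hV, t, i, ht⟩)
  refine ⟨y, section_ext _ _ _ fun p hp => ?_⟩
  obtain ⟨V, i, hV, t, ht⟩ := hex p hp
  refine ⟨V, i, hV, ?_⟩
  rw [map_tmul, hy V i t ⟨i, ht⟩, ht]

/-- Injectivity on small open subsets gives injectivity everywhere, and then local preimages
glue. -/
lemma isIso_of_locally_bijective (f : F ⟶ G)
    (h : ∀ (p : X) (U : X.Opens), p ∈ U →
      ∃ (V : X.Opens) (_ : V ⟶ U), p ∈ V ∧ Function.Bijective (f.app V)) : IsIso f := by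
  have map_app {U V : X.Opens} (i : V ⟶ U) (x : Γ(F, U)) :
      G.presheaf.map i.op (f.app U x) = f.app V (F.presheaf.map i.op x) :=
    (PresheafOfModules.naturality_apply f.val i.op x).symm
  have inj (U : X.Opens) : Function.Injective (f.app U) := by
    intro x y hxy
    refine section_ext _ _ _ fun p hp => ?_
    obtain ⟨V, i, hV, hf⟩ := h p U hp
    exact ⟨V, i, hV, hf.1 (by rw [← map_app, ← map_app, hxy])⟩
  rw [Scheme.Modules.Hom.isIso_iff_isIso_app]
  intro U
  rw [ConcreteCategory.isIso_iff_bijective]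
  refine ⟨inj U, fun x => ?_⟩
  obtain ⟨y, hy⟩ := exists_glue F U (fun V t => ∃ i : V ⟶ U, f.app V t = G.presheaf.map i.op x)
    (by
      rintro V W j t ⟨i, ht⟩
      refine ⟨j ≫ i, ?_⟩
      rw [← map_app, ht, map_map _ i j (j ≫ i)])
    (by
      rintro V t t' ⟨i, ht⟩ ⟨i', ht'⟩
      obtain rfl := Subsingleton.elim i i'
      exact inj V (ht.trans ht'.symm))
    (fun p hp => by
      obtain ⟨V, i, hV, hf⟩ := h p U hp
      obtain ⟨t, ht⟩ := hf.2 (G.presheaf.map i.op x)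
      exact ⟨V, i, hV, t, i, ht⟩)
  refine ⟨y, section_ext _ _ _ fun p hp => ?_⟩
  obtain ⟨V, i, hV, hf⟩ := h p U hp
  obtain ⟨t, ht⟩ := hf.2 (G.presheaf.map i.op x)
  refine ⟨V, i, hV, ?_⟩
  rw [map_app, hy V i t ⟨i, ht⟩, ht]

namespace CyclicDatum

variable {Y : Scheme.{u}} (D : CyclicDatum Y) {M : Y.Modules} {W : Y.Opens}

lemma tw_bijective {e : Γ(D.L, W)} (he : IsFreeGenerator e) :
    Function.Bijective fun t : Γ(M, D.img W) => D.tw e t :=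
  he.tmul_bijective.comp
    ((ConcreteCategory.isIso_iff_bijective (M.restrictAppIso D.σ.hom W).inv).mp inferInstance)

lemma sqRes_bijective (M : Y.Modules) : Function.Bijective (D.sqRes M (U := W)) :=
  (ConcreteCategory.isIso_iff_bijective
    (M.presheaf.map (eqToHom (D.img_img W).symm).op)).mp inferInstance

/-- As `φ` is surjective, the function `1` is a multiple of `φ(e ⊗ σ^* e')`. -/
lemma isUnit_pair [IsIso D.φ] {e : Γ(D.L, W)} (he : IsFreeGenerator e)
    {e' : Γ(D.L, D.img W)} (he' : IsFreeGenerator e') : IsUnit (D.pair e e') := by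
  have hφ := (ConcreteCategory.isIso_iff_bijective (D.φ.app W)).mp inferInstance
  obtain ⟨x, hx⟩ := hφ.2 (show Γ(structureSheaf Y, W) from (1 : Γ(Y, W)))
  obtain ⟨t, rfl⟩ := (D.tw_bijective (M := D.L) he).2 x
  obtain ⟨c, rfl⟩ := he'.bijective.2 t
  refine IsUnit.of_mul_eq_one_right (D.pullFun c) ?_
  rw [← D.pair_smul_right]
  exact hx

/-- In terms of local bases of `L` near a point and near its image under `σ`, the map `φ ⊗ 1` is
multiplication by a unit. -/
lemma isIso_theta [IsIso D.φ] (hL : IsVectorBundle 1 D.L) : IsIso D.theta := by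
  have key (M : Y.Modules) : IsIso (D.theta.app M) := by
    refine isIso_of_locally_bijective _ fun p U hp => ?_
    obtain ⟨U₁, hp₁, e₁, he₁⟩ := hL.exists_isFreeGenerator p
    obtain ⟨U₂, hp₂, e₂, he₂⟩ := hL.exists_isFreeGenerator (D.σ.hom p)
    let W : Y.Opens := U ⊓ U₁ ⊓ D.σ.hom ⁻¹ᵁ U₂
    have i₁ : W ⟶ U₁ := homOfLE (inf_le_left.trans inf_le_right)
    have i₂ : D.img W ⟶ U₂ := homOfLE
      ((D.img_mono inf_le_right).trans (Scheme.Hom.image_preimage_le _ _))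
    refine ⟨W, homOfLE (inf_le_left.trans inf_le_left), ⟨⟨hp, hp₁⟩, hp₂⟩, ?_⟩
    have hu := D.isUnit_pair (he₁.restrict i₁) (he₂.restrict i₂)
    have hb := (D.tw_bijective (M := D.twist.obj M) (he₁.restrict i₁)).comp
      (D.tw_bijective (M := M) (he₂.restrict i₂))
    rw [← hb.of_comp_iff]
    have : (D.theta.app M).app W ∘ ((fun t => D.tw (D.L.presheaf.map i₁.op e₁) t) ∘
        fun t => D.tw (D.L.presheaf.map i₂.op e₂) t) =
        (fun x => hu.unit • x) ∘ D.sqRes M := by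
      funext t
      exact D.theta_app_tw_tw _ _ _
    rw [this]
    exact (MulAction.bijective hu.unit).comp (D.sqRes_bijective M)
  exact NatIso.isIso_of_isIso_app _

end CyclicDatum

/-! ### Multiplication by global functions -/

section Scalar

variable {Y : Scheme.{u}} {M N : Y.Modules}

/-- The restriction to `U` of a global function. -/
def resFun (r : Γ(Y, ⊤)) (U : Y.Opens) : Γ(Y, U) := Y.presheaf.map (homOfLE le_top : U ⟶ ⊤).op r

lemma map_resFun (r : Γ(Y, ⊤)) {U V : Y.Opens} (i : V ⟶ U) :
    Y.presheaf.map i.op (resFun r U) = resFun r V := by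
  unfold resFun
  rw [← ConcreteCategory.comp_apply, ← Functor.map_comp]
  rfl

/-- The endomorphism of `M` given by multiplication by a global function. -/
def scalarEnd (M : Y.Modules) (r : Γ(Y, ⊤)) : M ⟶ M :=
  SheafOfModules.Hom.mk
    { app := fun U => ModuleCat.ofHom (X := M.val.obj U) (Y := M.val.obj U)
        (R := Y.ringCatSheaf.obj.obj U)
        (show Γ(M, U.unop) →ₗ[Γ(Y, U.unop)] Γ(M, U.unop) from
          LinearMap.lsmul Γ(Y, U.unop) Γ(M, U.unop) (resFun r U.unop))
      naturality := fun {U V} i => by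
        ext x
        refine Eq.trans ?_ (Scheme.Modules.map_smul M i.unop (resFun r U.unop) x).symm
        rw [map_resFun]
        rfl }

lemma scalarEnd_app (r : Γ(Y, ⊤)) {U : Y.Opens} (x : Γ(M, U)) :
    (scalarEnd M r).app U x = resFun r U • x := rfl

lemma scalarEnd_zero : scalarEnd M 0 = 0 := by
  ext U x
  rw [scalarEnd_app, resFun, map_zero, zero_smul]
  rfl

lemma scalarEnd_one : scalarEnd M 1 = 𝟙 M := by
  ext U x
  rw [scalarEnd_app, resFun, map_one, one_smul]
  rfl

lemma scalarEnd_add (r s : Γ(Y, ⊤)) : scalarEnd M (r + s) = scalarEnd M r + scalarEnd M s := by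
  ext U x
  rw [scalarEnd_app, resFun, map_add, add_smul]
  rfl

lemma scalarEnd_comp (r s : Γ(Y, ⊤)) : scalarEnd M r ≫ scalarEnd M s = scalarEnd M (r * s) := by
  ext U x
  rw [scalarEnd_app, resFun, mul_comm, map_mul, mul_smul]
  rfl

lemma comp_scalarEnd (f : M ⟶ N) (r : Γ(Y, ⊤)) : f ≫ scalarEnd N r = scalarEnd M r ≫ f := by
  ext U x
  exact (f.app_smul _ _).symm

lemma isIso_scalarEnd {r : Γ(Y, ⊤)} (hr : IsUnit r) : IsIso (scalarEnd M r) := by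
  obtain ⟨s, hs⟩ := hr.exists_right_inv
  exact ⟨scalarEnd M s, by rw [scalarEnd_comp, hs, scalarEnd_one],
    by rw [scalarEnd_comp, mul_comm, hs, scalarEnd_one]⟩

/-- Locally, an endomorphism of a line bundle is multiplication by a unique function; these functions
glue. -/
lemma IsVectorBundle.exists_eq_scalarEnd (hN : IsVectorBundle 1 N) (f : N ⟶ N) :
    ∃ r, f = scalarEnd N r := by
  let R (V : Y.Opens) (c : Γ(structureSheaf Y, V)) : Prop :=
    (∃ e : Γ(N, V), IsFreeGenerator e) ∧ ∀ (W : Y.Opens) (i : W ⟶ V) (x : Γ(N, W)),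
      f.app W x = Y.presheaf.map i.op (toRing c) • x
  have hR (p : Y) : ∃ V : Y.Opens, p ∈ V ∧ ∃ c, R V c := by
    obtain ⟨V, hp, e, he⟩ := hN.exists_isFreeGenerator p
    obtain ⟨c, hc⟩ := he.bijective.2 (f.app V e)
    refine ⟨V, hp, c, ⟨e, he⟩, fun W i x => ?_⟩
    obtain ⟨d, rfl⟩ := (he W i).2 x
    dsimp only at hc ⊢
    rw [f.app_smul, ← CyclicDatum.map_app, ← hc, Scheme.Modules.map_smul, smul_smul, smul_smul,
      mul_comm]
    rfl
  obtain ⟨r, hr⟩ : ∃ r : Γ(Y, ⊤), ∀ V c, R V c → resFun r V = toRing c := by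
    refine (exists_glue (structureSheaf Y) ⊤ R ?_ ?_ ?_).imp
      fun r hr V c hc => hr V (homOfLE le_top) c hc
    · rintro V W j c ⟨⟨e, he⟩, hc⟩
      refine ⟨⟨_, he.restrict j⟩, fun W' i x => ?_⟩
      rw [hc W' (i ≫ j) x, op_comp, Functor.map_comp]
      rfl
    · rintro V c c' ⟨⟨e, he⟩, hc⟩ ⟨-, hc'⟩
      refine he.bijective.1 ?_
      have h := (hc V (𝟙 V) e).symm.trans (hc' V (𝟙 V) e)
      rw [op_id, CategoryTheory.Functor.map_id] at h
      exact h
    · intro p _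
      obtain ⟨V, hV, c, hc⟩ := hR p
      exact ⟨V, homOfLE le_top, hV, c, hc⟩
  refine ⟨r, ?_⟩
  ext U x
  refine section_ext _ _ _ fun p hp => ?_
  obtain ⟨V, hV, c, hc⟩ := hR p
  refine ⟨U ⊓ V, homOfLE inf_le_left, ⟨hp, hV⟩, ?_⟩
  rw [CyclicDatum.map_app, CyclicDatum.map_app, scalarEnd_app,
    hc.2 (U ⊓ V) (homOfLE inf_le_right), ← hr V c hc,
    ← map_resFun r (homOfLE inf_le_right : U ⊓ V ⟶ V)]

lemma IsVectorBundle.hasLocalEnd (hY : IsField Γ(Y, ⊤)) (hN : IsVectorBundle 1 N) :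
    HasLocalEnd N := by
  intro b b' h
  obtain ⟨r, rfl⟩ := hN.exists_eq_scalarEnd b
  by_cases hr : r = 0
  · right
    rw [hr, scalarEnd_zero, zero_add] at h
    rw [h]
    infer_instance
  · obtain ⟨s, hs⟩ := hY.mul_inv_cancel hr
    exact Or.inl (isIso_scalarEnd (.of_mul_eq_one _ hs))

end Scalar

section Variety

variable {Y : Scheme.{u}} {k : Type u} [Field k] (p : Y ⟶ Spec (CommRingCat.of k))

attribute [local instance] MvPolynomial.gradedAlgebra in
/-- The global functions on an integral projective variety form a field. -/
lemma IsProjective.isField [IsIntegral Y] (hY : IsProjective p) : IsField Γ(Y, ⊤) := by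
  obtain ⟨n, i, hi, rfl⟩ := hY
  let 𝒜 := MvPolynomial.homogeneousSubmodule (Fin (n + 1)) k
  -- The polynomials of degree zero are the constants, so `Proj` is proper over `Spec k`.
  have hb : Function.Bijective (algebraMap k (𝒜 0)) := by
    refine ⟨fun c d h => MvPolynomial.C_injective (Fin (n + 1)) k (congrArg Subtype.val h),
      fun x => ?_⟩
    have hx := x.2
    rw [MvPolynomial.mem_homogeneousSubmodule] at hx
    obtain ⟨c, hc⟩ : ∃ c, MvPolynomial.C c = x.1 :=
      ⟨_, (MvPolynomial.totalDegree_eq_zero_iff_eq_C.mp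
        (MvPolynomial.IsHomogeneous.totalDegree_le hx |> Nat.le_zero.mp)).symm⟩
    exact ⟨c, Subtype.ext hc⟩
  have : IsScalarTower k (𝒜 0) (MvPolynomial (Fin (n + 1)) k) :=
    IsScalarTower.of_algebraMap_eq (R := k) (S := 𝒜 0) (A := MvPolynomial (Fin (n + 1)) k)
      fun _ => rfl
  have : Algebra.FiniteType (𝒜 0) (MvPolynomial (Fin (n + 1)) k) :=
    Algebra.FiniteType.of_restrictScalars_finiteType k _ _
  have : IsIso (CommRingCat.ofHom (algebraMap k (𝒜 0))) :=
    (ConcreteCategory.isIso_iff_bijective _).mpr hb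
  exact isField_of_universallyClosed k (i ≫ Proj.toSpecZero 𝒜 ≫
    Spec.map (CommRingCat.ofHom (algebraMap k (𝒜 0))))

variable {M N : Y.Modules}

/-- The multiplication by the constant `c` on `M`. -/
def constEnd (M : Y.Modules) (c : k) : M ⟶ M := scalarEnd M (constant p c ⊤)

lemma resFun_constant (c : k) (U : Y.Opens) : resFun (constant p c ⊤) U = constant p c U := by
  unfold resFun constant
  rw [← ConcreteCategory.comp_apply, ← Functor.map_comp]
  rfl

lemma constEnd_app (c : k) {U : Y.Opens} (x : Γ(M, U)) :
    (constEnd p M c).app U x = constant p c U • x := by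
  rw [← resFun_constant]
  rfl

lemma constEnd_zero : constEnd p M 0 = 0 := by
  rw [constEnd, constant, map_zero, map_zero, map_zero, scalarEnd_zero]

lemma constEnd_one : constEnd p M 1 = 𝟙 M := by
  rw [constEnd, constant, map_one, map_one, map_one, scalarEnd_one]

lemma constEnd_add (c d : k) : constEnd p M (c + d) = constEnd p M c + constEnd p M d := by
  simp only [constEnd, constant, map_add, scalarEnd_add]

lemma constEnd_comp (c d : k) : constEnd p M c ≫ constEnd p M d = constEnd p M (c * d) := by
  simp only [constEnd, constant, map_mul, scalarEnd_comp]

lemma constEnd_neg_one : constEnd p M (-1) = -𝟙 M := by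
  rw [eq_neg_iff_add_eq_zero, ← constEnd_one p, ← constEnd_add, neg_add_cancel, constEnd_zero]

lemma comp_constEnd (f : M ⟶ N) (c : k) : f ≫ constEnd p N c = constEnd p M c ≫ f :=
  comp_scalarEnd _ _

lemma constant_eq (c : k) (U : Y.Opens) (hU : U ≤ p ⁻¹ᵁ ⊤) : constant p c U =
    p.appLE ⊤ U hU ((Scheme.ΓSpecIso (CommRingCat.of k)).inv c) := rfl

/-- As `σ` is a morphism over `k`, pull-back by `σ` preserves constants. -/
lemma CyclicDatum.pullFun_constant (D : CyclicDatum Y) (hσ : D.σ.hom ≫ p = p) (c : k)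
    (U : Y.Opens) : D.pullFun (constant p c (D.img U)) = constant p c U := by
  have hU (V : Y.Opens) : V ≤ p ⁻¹ᵁ ⊤ := le_top
  rw [constant_eq _ _ _ (hU _), constant_eq _ _ _ (hU _), pullFun, ← ConcreteCategory.comp_apply, Scheme.Hom.appIso_hom',
    Scheme.Hom.appLE_comp_appLE]
  simp only [hσ]

lemma CyclicDatum.twist_map_constEnd (D : CyclicDatum Y) (hσ : D.σ.hom ≫ p = p) (c : k) :
    D.twist.map (constEnd p M c) = constEnd p (D.twist.obj M) c := by
  refine D.twist_hom_ext fun U s t => ?_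
  rw [D.twist_map_tw, constEnd_app, constEnd_app, D.tw_smul_right, D.pullFun_constant p hσ]

end Variety

/-! ### Module structures on simple bundles -/

section Simple

variable {Y : Scheme.{u}} {k : Type u} [Field k] {p : Y ⟶ Spec (CommRingCat.of k)}
  {D : CyclicDatum Y} {M : Y.Modules}

lemma IsSimple.exists_eq_constEnd (hM : IsSimple p M) (f : M ⟶ M) : ∃ c, f = constEnd p M c := by
  obtain ⟨c, hc, -⟩ := hM f
  refine ⟨c, ?_⟩
  ext U x
  rw [hc U x, constEnd_app]

lemma IsSimple.constEnd_injective (hM : IsSimple p M) : Function.Injective (constEnd p M) := by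
  intro c d h
  refine (hM (constEnd p M c)).unique (fun U x => constEnd_app p c x) fun U x => ?_
  rw [h, constEnd_app]

lemma IsSimple.ne_zero_of_isIso (hM : IsSimple p M) {c : k} (hc : IsIso (constEnd p M c)) :
    c ≠ 0 := by
  rintro rfl
  have h : constEnd p M 1 = constEnd p M 0 := by
    rw [constEnd_one, ← IsIso.hom_inv_id (constEnd p M 0)]
    conv_lhs => arg 1; rw [constEnd_zero]
    rw [zero_comp, constEnd_zero]
  exact one_ne_zero (hM.constEnd_injective h)

/-- A scaling `a = d g` of an isomorphism `g : L_σ ⊗ M ≅ M` satisfies `F a ≫ a = θ`, where `d` is a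
square root of the inverse of the constant `c` with `F g ≫ g = c θ`. -/
lemma IsSimple.exists_twistAct [IsAlgClosed k] (hM : IsSimple p M) (hσ : D.σ.hom ≫ p = p)
    [IsIso D.theta] (g : D.twist.obj M ≅ M) :
    ∃ a : D.twist.obj M ⟶ M, D.twist.map a ≫ a = D.theta.app M := by
  obtain ⟨c, hc⟩ := hM.exists_eq_constEnd (inv (D.theta.app M) ≫ D.twist.map g.hom ≫ g.hom)
  have hc0 : c ≠ 0 := hM.ne_zero_of_isIso (hc ▸ inferInstance)
  obtain ⟨d, hd⟩ := IsAlgClosed.exists_pow_nat_eq c⁻¹ (n := 2) two_pos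
  refine ⟨g.hom ≫ constEnd p M d, ?_⟩
  rw [IsIso.inv_comp_eq] at hc
  rw [Functor.map_comp, D.twist_map_constEnd p hσ, Category.assoc, ← Category.assoc (constEnd p _ d),
    ← comp_constEnd, Category.assoc, constEnd_comp, reassoc_of% hc, constEnd_comp, ← sq, hd,
    mul_inv_cancel₀ hc0, constEnd_one, Category.comp_id]

variable {hD : ∀ X, D.twist.map (D.theta.app X) = D.theta.app (D.twist.obj X)}

/-- Two actions on a simple bundle differ by a constant with square one. -/
lemma IsSimple.twistAct_eq_or_eq_neg (hM : IsSimple p M) (hσ : D.σ.hom ≫ p = p)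
    [IsIso D.theta] (S S' : ModuleStructure (quadraticMonad D.twist D.theta hD) M) :
    S'.twistAct = S.twistAct ∨ S'.twistAct = -S.twistAct := by
  have := S.isIso_twistAct
  obtain ⟨c, hc⟩ := hM.exists_eq_constEnd (inv S.twistAct ≫ S'.twistAct)
  rw [IsIso.inv_comp_eq] at hc
  have h := S'.map_twistAct_comp
  rw [hc, Functor.map_comp, D.twist_map_constEnd p hσ, Category.assoc,
    ← Category.assoc (constEnd p _ c), ← comp_constEnd, Category.assoc, constEnd_comp,
    ← Category.assoc, S.map_twistAct_comp] at h
  have h' : constEnd p M (c * c) = constEnd p M 1 := by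
    rw [← cancel_epi (D.theta.app M), constEnd_one]
    exact h.trans (Category.comp_id _).symm
  rcases mul_self_eq_one_iff.mp (hM.constEnd_injective h') with rfl | rfl
  · left
    rw [hc, constEnd_one, Category.comp_id]
  · right
    rw [hc, constEnd_neg_one, Preadditive.comp_neg, Category.comp_id]

lemma IsSimple.twistAct_ne_neg [CharZero k] (hM : IsSimple p M) [IsIso D.theta]
    (S : ModuleStructure (quadraticMonad D.twist D.theta hD) M) : S.twistAct ≠ -S.twistAct := by
  intro h
  have := S.isIso_twistAct
  have h' : constEnd p M 1 = constEnd p M (-1) := by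
    rw [← cancel_epi S.twistAct, constEnd_one, constEnd_neg_one, Preadditive.comp_neg,
      Category.comp_id]
    exact h
  have h2 := hM.constEnd_injective h'
  norm_num [eq_neg_iff_add_eq_zero] at h2

lemma IsSimple.natCard_moduleStructure [IsAlgClosed k] [CharZero k] (hM : IsSimple p M)
    (hσ : D.σ.hom ≫ p = p) [IsIso D.theta] (g : D.twist.obj M ≅ M) :
    Nat.card (ModuleStructure (quadraticMonad D.twist D.theta hD) M) = 2 := by
  obtain ⟨a, ha⟩ := hM.exists_twistAct hσ g
  let S₁ : ModuleStructure (quadraticMonad D.twist D.theta hD) M := .mkTwist a ha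
  let S₂ : ModuleStructure (quadraticMonad D.twist D.theta hD) M :=
    .mkTwist (-a) (by simpa using ha)
  have h₁ : S₁.twistAct = a := ModuleStructure.mkTwist_twistAct a ha
  have h₂ : S₂.twistAct = -a := ModuleStructure.mkTwist_twistAct (-a) _
  refine Nat.card_eq_two_iff.mpr ⟨S₁, S₂, fun h => ?_, Set.eq_univ_of_forall fun S => ?_⟩
  · exact hM.twistAct_ne_neg S₁ ((congrArg _ h).trans (h₂.trans (congrArg _ h₁.symm)))
  · rcases hM.twistAct_eq_or_eq_neg hσ S₁ S with h | h
    · exact Or.inl (ModuleStructure.ext_twistAct h)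
    · exact Or.inr (ModuleStructure.ext_twistAct (by rw [h, h₁, h₂]))

/-- An isomorphism of modules is a constant, hence commutes with the actions. -/
lemma IsSimple.eq_of_iso (hM : IsSimple p M) (hσ : D.σ.hom ≫ p = p)
    {S S' : ModuleStructure (quadraticMonad D.twist D.theta hD) M}
    (f : S.toModule ≅ S'.toModule) : S = S' := by
  have h := ModuleStructure.twistAct_comp f.hom
  have hf : IsIso (show M ⟶ M from f.hom.f) :=
    (inferInstance : IsIso ((Monad.forget _).map f.hom))
  generalize (show M ⟶ M from f.hom.f) = g at h hf
  obtain ⟨c, rfl⟩ := hM.exists_eq_constEnd g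
  rw [D.twist_map_constEnd p hσ, ← comp_constEnd, cancel_mono] at h
  exact ModuleStructure.ext_twistAct h.symm

end Simple

end CyclicCover

end

theorem mainTheorem10 {k : Type u} [Field k] [IsAlgClosed k] [CharZero k]
    (Y : Scheme.{u}) (p : Y ⟶ Spec (CommRingCat.of k)) [IsIntegral Y]
    [SmoothOfRelativeDimension 2 p] (hY : CyclicCover.IsProjective p)
    (D : CyclicCover.CyclicDatum Y) (hσk : D.σ.hom ≫ p = p) (hσ : D.σ.hom ≠ 𝟙 Y)
    (hL : CyclicCover.IsVectorBundle 1 D.L) (hφ : IsIso D.φ) (hD : D.Overlap)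
    (hcob : ¬ D.IsCoboundary)
    (M : Y.Modules) (hM : CyclicCover.IsVectorBundle 2 M) :
    (CyclicCover.IsSplit M →
      ∀ S₁ S₂ : CyclicCover.ModuleStructure (D.algebra hD) M,
        Nonempty (S₁.toModule ≅ S₂.toModule)) ∧
    (CyclicCover.IsSimple p M →
      (¬ Nonempty (CyclicCover.tensor D.L (M.restrict D.σ.hom) ≅ M) →
        IsEmpty (CyclicCover.ModuleStructure (D.algebra hD) M)) ∧
      (Nonempty (CyclicCover.tensor D.L (M.restrict D.σ.hom) ≅ M) →
        Nat.card (CyclicCover.ModuleStructure (D.algebra hD) M) = 2 ∧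
        ∀ S₁ S₂ : CyclicCover.ModuleStructure (D.algebra hD) M,
          Nonempty (S₁.toModule ≅ S₂.toModule) → S₁ = S₂)) := by
  have := D.isIso_theta hL
  refine ⟨?_, fun hs => ⟨fun hM' => ⟨fun S => hM' ⟨?_⟩⟩, fun ⟨g⟩ => ⟨?_, fun S₁ S₂ ⟨f⟩ => ?_⟩⟩⟩
  · rintro ⟨N, N', hN, hN', ⟨e⟩⟩ S₁ S₂
    have hF (P : Y.Modules) (hP : CyclicCover.IsVectorBundle 1 P) :
        ¬ Nonempty (D.twist.obj P ≅ P) := fun h => hcob ⟨P, hP, h⟩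
    have hfree (S : CyclicCover.ModuleStructure (D.algebra hD) M) :=
      S.nonempty_free_iso e (hN.hasLocalEnd (hY.isField p)) (hN'.hasLocalEnd (hY.isField p))
        (hF N hN) (hF N' hN')
    obtain ⟨e₁⟩ := hfree S₁
    obtain ⟨e₂⟩ := hfree S₂
    exact ⟨e₁.symm ≪≫ e₂⟩
  · exact @asIso _ _ _ _ S.twistAct S.isIso_twistAct
  · exact hs.natCard_moduleStructure hσk g
  · exact hs.eq_of_iso hσk f
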